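/- Let $d\ge 0$ and let $F:\mathbb R^d\to\mathbb R^d$, $x^*\in\mathbb R^d$ with $F(x^*)=0$, satisfy, for some $\mu>0$ and $L\ge 0$: - (quasi-strong monotonicity) $\langle F(x),x-x^*\rangle\ge \mu\|x-x^*\|^2$ for all $x\in\mathbb R^d$; - (smoothness) $F$ is $L$-Lipschitz and of class $C^4$, and $\sup_x\|\nabla^iF(x)\|<\infty$ for $i=1,\dots,4$. Let $(U_t)_{t\ge 0}$ be i.i.d. (jointly measurable) random fields $U_t:\mathbb R^d\to\mathbb R^d$ on a probability space such that, for some constants $\sigma>0$, $\kappa$, $G$: - there is a filtration $(\mathcal F_t)_{t\ge0}$ such that, for all $t$ and $x$, $U_t(x)$ is square-integrable and $\mathcal F_{t+1}$-measurable, $\mathbb E[U_t(x)\mid\mathcal F_t]=0$ and $\mathbb E[\|U_t(x)\|^2\mid\mathcal F_t]\le\sigma^2$ almost surely; - $U_t(x)=U_t^a(x)+U_t^b(x)$ with $U_t^a(x)$ and $U_t^b(x)$ independent, where $U_t^a(x)$ has a density $p_{t,x}$ with respect to Lebesgue measure and $\inf_{x\in C}p_{t,x}(v)>0$ for every bounded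 $C\subseteq\mathbb R^d$ and every $v\in\mathbb R^d$; - $\mathbb E\|U_t(x)\|^4<\kappa^4$ for all $t$ and $x$, and the covariance tensor $\mathcal C(x)=\mathbb E[U_t(x)^{\otimes 2}]$ is of class $C^3$ with $\|\mathcal C^{(i)}(x)\|<G$ for all $x$ and $i=1,2,3$. For a step-size $\gamma>0$ consider SGDA, $x_{t+1}=x_t-\gamma\,(F(x_t)+U_t(x_t))$, that is, the Markov chain on $\mathbb R^d$ with transition kernel $P_\gamma(x,B)=\mathbb P\big(x-\gamma(F(x)+U_t(x))\in B\big)$. Then there is $\theta>0$ such that: 1. for every $\gamma\in(0,\theta)$, SGDA has exactly one stationary distribution $\pi_\gamma$ (invariant probability measure of $P_\gamma$), and $\pi_\gamma$ has a finite first moment; 2. there are a vector $\Delta=\Delta(x^*)\in\mathbb R^d$ and a constant $K$, both independent of $\gamma$, such that for every $\gamma\in(0,\theta)$ $$\big\|\mathbb E_{x\sim\pi_\gamma}[x]-x^*-\gamma\,\Delta(x^*)\big\|\le K\gamma^2 ;$$ 3. consequently (Richardson–Romberg extrapolation) there is a constant $K'$ such that, whenever $\gamma>0$ and $2\gamma<\theta$,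 $$\big\|2\,\mathbb E_{x\sim\pi_\gamma}[x]-\mathbb E_{x\sim\pi_{2\gamma}}[x]-x^*\big\|\le K'\gamma^2 .$$ -/

import Mathlib

open MeasureTheory ProbabilityTheory
open scoped NNReal ENNReal

/-- The Euclidean space `ℝ^d`. -/
abbrev Eucl (d : ℕ) : Type := EuclideanSpace ℝ (Fin d)

/-- `F` is `lam`-weak `m`-quasi strongly monotone around `xs`:
`⟨F x, x - xs⟩ ≥ m ‖x - xs‖² - lam` for all `x`. -/
def WeakQuasiStronglyMonotone {d : ℕ} (F : Eucl d → Eucl d) (xs : Eucl d) (m lam : ℝ) : Prop :=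
  ∀ x, inner ℝ (F x) (x - xs) ≥ m * ‖x - xs‖ ^ 2 - lam

/-- `F` is `L`-Lipschitz and `C⁴`, with bounded derivatives of orders `1, …, 4`. -/
structure SmoothOperator {d : ℕ} (F : Eucl d → Eucl d) (L : ℝ≥0) : Prop where
  lipschitz : LipschitzWith L F
  contDiff : ContDiff ℝ 4 F
  bounded : ∀ i ∈ Finset.Icc 1 4, ∃ K : ℝ, ∀ x, ‖iteratedFDeriv ℝ i F x‖ ≤ K

/-- The noise of a stochastic oracle: `U t x` is the noise at time `t` and at the point `x`.
The random fields `U 0, U 1, …` are i.i.d. (their laws live on `Eucl d → Eucl d` with the product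
σ-algebra) and, for a filtration, each `U t x` is known at time `t + 1`, and has conditionally
on time `t` zero mean and second moment at most `σ²`. -/
structure OracleNoise {d : ℕ} {Ω : Type*} [mΩ : MeasurableSpace Ω] (P : Measure Ω)
    (U : ℕ → Eucl d → Ω → Eucl d) (σ : ℝ) : Prop where
  /-- joint measurability, so that the noise may be evaluated at a random point -/
  measurable : ∀ t, Measurable (fun p : Eucl d × Ω => U t p.1 p.2)
  indep : iIndepFun (fun t ω x => U t x ω) P
  identDistrib : ∀ t, IdentDistrib (fun ω x => U t x ω) (fun ω x => U 0 x ω) P P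
  memLp_two : ∀ t x, MemLp (U t x) 2 P
  filtration : ∃ ℱ : Filtration ℕ mΩ, ∀ t x,
    Measurable[ℱ (t + 1)] (U t x) ∧
    P[U t x | ℱ t] =ᵐ[P] (fun _ => 0) ∧
    P[fun ω => ‖U t x ω‖ ^ 2 | ℱ t] ≤ᵐ[P] (fun _ => σ ^ 2)

/-- The noise splits as a sum `Ua + Ub` of independent parts, the law of `Ua t x` having a
Lebesgue density `p t x` which, at each argument `v`, is bounded away from zero uniformly over
`x` in any bounded set. -/
def PositiveDensityComponent {d : ℕ} {Ω : Type*} [MeasurableSpace Ω] (P : Measure Ω)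
    (U : ℕ → Eucl d → Ω → Eucl d) : Prop :=
  ∃ (Ua Ub : ℕ → Eucl d → Ω → Eucl d) (p : ℕ → Eucl d → Eucl d → ℝ≥0∞), ∀ t,
    (∀ x, Measurable (Ua t x) ∧ Measurable (Ub t x) ∧ Measurable (p t x) ∧
      (∀ ω, U t x ω = Ua t x ω + Ub t x ω) ∧
      IndepFun (Ua t x) (Ub t x) P ∧
      P.map (Ua t x) = (volume : Measure (Eucl d)).withDensity (p t x)) ∧
    ∀ C : Set (Eucl d), Bornology.IsBounded C → ∀ v, 0 < ⨅ x ∈ C, p t x v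

/-- The entries `𝔼[V(x)_i V(x)_j]` of the covariance tensor of a centred random field `V`. -/
noncomputable def covTensor {d : ℕ} {Ω : Type*} [MeasurableSpace Ω] (P : Measure Ω)
    (V : Eucl d → Ω → Eucl d) (x : Eucl d) : Fin d → Fin d → ℝ :=
  fun i j => ∫ ω, V x ω i * V x ω j ∂P

/-- Fourth moments of the noise below `κ⁴`, and a `C³` covariance tensor whose derivatives of
orders `1, 2, 3` are bounded by `G`. -/
structure RegularNoise {d : ℕ} {Ω : Type*} [MeasurableSpace Ω] (P : Measure Ω)
    (U : ℕ → Eucl d → Ω → Eucl d) (κ G : ℝ) : Prop where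
  integrable_four : ∀ t x, Integrable (fun ω => ‖U t x ω‖ ^ 4) P
  fourth_moment : ∀ t x, ∫ ω, ‖U t x ω‖ ^ 4 ∂P < κ ^ 4
  cov_contDiff : ∀ t, ContDiff ℝ 3 (covTensor P (U t))
  cov_bounded : ∀ t, ∀ i ∈ Finset.Icc 1 3, ∀ x, ‖iteratedFDeriv ℝ i (covTensor P (U t)) x‖ < G

/-- The transition kernel of one step `x ↦ x - γ (F x + V x)` of stochastic gradient
descent-ascent, with fresh noise `V`. (`Kernel.map` is the zero kernel if the step is not
measurable; see `sgdaKernel_apply` for the formula.) -/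
noncomputable def sgdaKernel {d : ℕ} {Ω : Type*} [MeasurableSpace Ω] (P : Measure Ω)
    (F : Eucl d → Eucl d) (V : Eucl d → Ω → Eucl d) (γ : ℝ) : Kernel (Eucl d) (Eucl d) :=
  (Kernel.id ×ₖ Kernel.const (Eucl d) P).map (fun p => p.1 - γ • (F p.1 + V p.1 p.2))

theorem sgdaKernel_apply {d : ℕ} {Ω : Type*} [MeasurableSpace Ω] (P : Measure Ω)
    [IsProbabilityMeasure P] (F : Eucl d → Eucl d) (hF : Measurable F) (V : Eucl d → Ω → Eucl d)
    (hV : Measurable (fun p : Eucl d × Ω => V p.1 p.2)) (γ : ℝ) (x : Eucl d) (B : Set (Eucl d))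
    (hB : MeasurableSet B) :
    sgdaKernel P F V γ x B = P {ω | x - γ • (F x + V x ω) ∈ B} := by
  have hm : Measurable (fun p : Eucl d × Ω => p.1 - γ • (F p.1 + V p.1 p.2)) := by
    fun_prop
  rw [sgdaKernel, Kernel.map_apply' _ hm _ hB, Kernel.prod_apply, Kernel.id_apply,
    Kernel.const_apply, Measure.dirac_prod, Measure.map_apply (by fun_prop) (hm hB)]
  rfl

/-- `π` is a stationary distribution of SGDA with operator `F`, noise fields `U t` and constant
step-size `γ`: a probability measure that is invariant under the transition kernel (at each
time `t`; the kernels agree for identically distributed noise). -/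
structure SGDAStationary {d : ℕ} {Ω : Type*} [MeasurableSpace Ω] (P : Measure Ω)
    (F : Eucl d → Eucl d) (U : ℕ → Eucl d → Ω → Eucl d) (γ : ℝ) (π : Measure (Eucl d)) :
    Prop where
  isProbabilityMeasure : IsProbabilityMeasure π
  invariant : ∀ t, Kernel.Invariant (sgdaKernel P F (U t) γ) π

/-!
Write `m_k` for the `k`-th moment of `x - x*` under the stationary law. Far from `x*` the Lyapunov
function `V = ‖x - x*‖⁴` contracts, `P V ≤ (1 - cγ) V + O(γ³)`, and the everywhere positive
density of the noise gives a minorization on bounded sets; by Harris' theorem there is a unique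
stationary law, and integrating the drift inequality against it yields `∫ ‖x - x*‖⁴ = O(γ²)`.

The stationary law gives the same integral to `f` and to `P f`. For linear, quadratic and cubic `f`
this produces, up to `O(γ²)`, linear equations for the first three moments: `E F(x) = 0`, a Lyapunov
equation `∇F(x*) m₂ + m₂ ∇F(x*)ᵀ = γ · Cov(U(x*))`, and `m₃ = O(γ²)`. Both moment equations are
solvable because `-∇F(x*)` generates an exponentially contracting semigroup. Expanding `E F(x) = 0`
to second order at `x*` then expresses the bias as `γ Δ + O(γ²)`, with `Δ` independent of `γ`, and
the combination of step sizes `γ` and `2γ` cancels the linear term.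
-/

section UniformLimits

open Filter Topology

variable {X : Type*} [MeasurableSpace X]

theorem hasSum_of_forall_abs_sub_measureReal_le {μ : ℕ → Measure X} [∀ n, IsFiniteMeasure (μ n)]
    {l : Set X → ℝ} {ε : ℕ → ℝ} (hε : Tendsto ε atTop (𝓝 0))
    (h : ∀ n A, MeasurableSet A → |l A - (μ n).real A| ≤ ε n) {f : ℕ → Set X}
    (hf : ∀ i, MeasurableSet (f i)) (hd : Pairwise (Function.onFun Disjoint f)) :
    HasSum (fun i => l (f i)) (l (⋃ i, f i)) := by
  have hlim : ∀ A, MeasurableSet A → Tendsto (fun n => (μ n).real A) atTop (𝓝 (l A)) :=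
    fun A hA => tendsto_iff_norm_sub_tendsto_zero.2 <|
      squeeze_zero (fun _ => norm_nonneg _) (fun n => by rw [norm_sub_rev]; exact h n A hA) hε
  have hUnion : ∀ s : Finset ℕ, MeasurableSet (⋃ i ∈ s, f i) := fun s =>
    s.measurableSet_biUnion fun i _ => hf i
  have hadd : ∀ n (s : Finset ℕ), ∑ i ∈ s, (μ n).real (f i) = (μ n).real (⋃ i ∈ s, f i) :=
    fun n s => (measureReal_biUnion_finset (fun i _ j _ hij => hd hij) fun i _ => hf i).symm
  have hladd : ∀ s : Finset ℕ, ∑ i ∈ s, l (f i) = l (⋃ i ∈ s, f i) := fun s =>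
    tendsto_nhds_unique (tendsto_finsetSum _ fun i _ => hlim _ (hf i))
      ((hlim _ (hUnion s)).congr fun n => (hadd n s).symm)
  have hunif : TendstoUniformly (fun n (s : Finset ℕ) => ∑ i ∈ s, (μ n).real (f i))
      (fun s => ∑ i ∈ s, l (f i)) atTop := by
    refine Metric.tendstoUniformly_iff.2 fun δ hδ => ?_
    filter_upwards [hε.eventually_lt_const hδ] with n hn s
    rw [hladd, hadd]
    exact (h n _ (hUnion s)).trans_lt hn
  have hsum : ∀ n, HasSum (fun i => (μ n).real (f i)) ((μ n).real (⋃ i, f i)) := fun n => by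
    have hfin : ∑' i, μ n (f i) ≠ ∞ := (measure_iUnion hd hf).symm ▸ measure_ne_top (μ n) _
    rw [measureReal_def, measure_iUnion hd hf,
      ENNReal.tsum_toReal_eq fun i => measure_ne_top (μ n) _]
    exact ENNReal.hasSum_toReal hfin
  exact hunif.tendsto_of_eventually_tendsto (Eventually.of_forall hsum)
    (hlim _ (MeasurableSet.iUnion hf))

theorem exists_isProbabilityMeasure_of_forall_abs_sub_measureReal_le {μ : ℕ → Measure X}
    [∀ n, IsProbabilityMeasure (μ n)] {l : Set X → ℝ} {ε : ℕ → ℝ} (hε : Tendsto ε atTop (𝓝 0))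
    (h : ∀ n A, MeasurableSet A → |l A - (μ n).real A| ≤ ε n) :
    ∃ π : Measure X, IsProbabilityMeasure π ∧ ∀ A, MeasurableSet A → π.real A = l A := by
  have hlim : ∀ A, MeasurableSet A → Tendsto (fun n => (μ n).real A) atTop (𝓝 (l A)) :=
    fun A hA => tendsto_iff_norm_sub_tendsto_zero.2 <|
      squeeze_zero (fun _ => norm_nonneg _) (fun n => by rw [norm_sub_rev]; exact h n A hA) hε
  have hnonneg : ∀ A, MeasurableSet A → 0 ≤ l A := fun A hA =>
    ge_of_tendsto' (hlim A hA) fun _ => measureReal_nonneg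
  have hempty : l ∅ = 0 := tendsto_nhds_unique (hlim ∅ .empty) (by simp)
  have huniv : l Set.univ = 1 := tendsto_nhds_unique (hlim _ .univ) (by simp)
  let π : Measure X := Measure.ofMeasurable (fun A _ => ENNReal.ofReal (l A)) (by simp [hempty])
    fun f hf hd => by
      have hsum := hasSum_of_forall_abs_sub_measureReal_le hε h hf hd
      rw [← hsum.tsum_eq, ENNReal.ofReal_tsum_of_nonneg (fun i => hnonneg _ (hf i)) hsum.summable]
  have hπ : ∀ A, MeasurableSet A → π A = ENNReal.ofReal (l A) := fun A hA =>
    Measure.ofMeasurable_apply A hA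
  exact ⟨π, ⟨by rw [hπ _ .univ, huniv, ENNReal.ofReal_one]⟩, fun A hA => by
    rw [measureReal_def, hπ A hA, ENNReal.toReal_ofReal (hnonneg A hA)]⟩

theorem exists_isProbabilityMeasure_of_uniformCauchy {μ : ℕ → Measure X}
    [∀ n, IsProbabilityMeasure (μ n)] {ε : ℕ → ℝ} (hε : Tendsto ε atTop (𝓝 0))
    (h : ∀ n k A, MeasurableSet A → |(μ (n + k)).real A - (μ n).real A| ≤ ε n) :
    ∃ π : Measure X, IsProbabilityMeasure π ∧
      ∀ n A, MeasurableSet A → |π.real A - (μ n).real A| ≤ ε n := by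
  have hcauchy : ∀ A, MeasurableSet A → CauchySeq fun n => (μ n).real A := fun A hA => by
    refine cauchySeq_of_le_tendsto_0' ε (fun n m hnm => ?_) hε
    obtain ⟨k, rfl⟩ := Nat.exists_eq_add_of_le hnm
    rw [dist_comm]
    exact h n k A hA
  choose! l hl using fun A hA => cauchySeq_tendsto_of_complete (hcauchy A hA)
  have hlε : ∀ n A, MeasurableSet A → |l A - (μ n).real A| ≤ ε n := fun n A hA =>
    le_of_tendsto' ((((tendsto_add_atTop_iff_nat n).2 (hl A hA)).sub_const _).abs)
      fun k => by rw [add_comm]; exact h n k A hA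
  obtain ⟨π, hπ, hπl⟩ := exists_isProbabilityMeasure_of_forall_abs_sub_measureReal_le hε hlε
  exact ⟨π, hπ, fun n A hA => by rw [hπl A hA]; exact hlε n A hA⟩

theorem abs_integral_sub_integral_le_of_measureReal {π μ : Measure X} [IsProbabilityMeasure π]
    [IsProbabilityMeasure μ] {ε : ℝ} (h : ∀ A, MeasurableSet A → |π.real A - μ.real A| ≤ ε)
    {φ : X → ℝ} (hφ : Measurable φ) (hφ01 : ∀ x, φ x ∈ Set.Icc (0 : ℝ) 1) :
    |∫ x, φ x ∂π - ∫ x, φ x ∂μ| ≤ ε := by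
  have hlayer : ∀ (ν : Measure X) [IsProbabilityMeasure ν],
      ∫ x, φ x ∂ν = ∫ t in Set.Ioc (0 : ℝ) 1, ν.real {a | t ≤ φ a} := fun ν _ =>
    (Integrable.of_mem_Icc 0 1 hφ.aemeasurable (.of_forall hφ01)).integral_eq_integral_Ioc_meas_le
      (.of_forall fun x => (hφ01 x).1) (.of_forall fun x => (hφ01 x).2)
  have hint : ∀ (ν : Measure X) [IsProbabilityMeasure ν],
      IntegrableOn (fun t => ν.real {a | t ≤ φ a}) (Set.Ioc 0 1) := fun ν _ => by
    have hanti : Antitone fun t => ν.real {a | t ≤ φ a} :=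
      fun s t hst => measureReal_mono fun a ha => hst.trans ha
    exact Integrable.of_mem_Icc 0 1 hanti.measurable.aemeasurable
      (.of_forall fun t => ⟨measureReal_nonneg, measureReal_le_one⟩)
  rw [hlayer π, hlayer μ, ← integral_sub (hint π) (hint μ)]
  simpa using norm_setIntegral_le_of_norm_le_const (μ := volume) (s := Set.Ioc (0 : ℝ) 1) (C := ε)
    (f := fun t => π.real {a | t ≤ φ a} - μ.real {a | t ≤ φ a}) (by simp)
    fun t _ => h _ (measurableSet_le measurable_const hφ)

end UniformLimits

section Harris

open Filter Topology

variable {X : Type*} [MeasurableSpace X]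

/-- The `n`-step kernel of the Markov chain with transition kernel `κ`. -/
noncomputable def kernelPow (κ : Kernel X X) : ℕ → Kernel X X
  | 0 => Kernel.id
  | n + 1 => kernelPow κ n ∘ₖ κ

instance isMarkovKernel_kernelPow (κ : Kernel X X) [IsMarkovKernel κ] (n : ℕ) :
    IsMarkovKernel (kernelPow κ n) := by
  induction n with
  | zero => unfold kernelPow; infer_instance
  | succ n ih => unfold kernelPow; infer_instance

theorem kernelPow_add (κ : Kernel X X) (m n : ℕ) :
    kernelPow κ (m + n) = kernelPow κ m ∘ₖ kernelPow κ n := by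
  induction n with
  | zero => exact (Kernel.comp_id _).symm
  | succ n ih => rw [← add_assoc, kernelPow, ih, kernelPow, Kernel.comp_assoc]

theorem kernelPow_one (κ : Kernel X X) : kernelPow κ 1 = κ := Kernel.id_comp κ

theorem invariant_kernelPow {κ : Kernel X X} {ν : Measure X} (hν : Kernel.Invariant κ ν) (n : ℕ) :
    Kernel.Invariant (kernelPow κ n) ν := by
  induction n with
  | zero => exact Measure.bind_dirac
  | succ n ih => exact ih.comp hν

theorem measureReal_bind_eq_integral {κ : Kernel X X} [IsMarkovKernel κ] {μ : Measure X}
    {A : Set X} (hA : MeasurableSet A) :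
    (μ.bind κ).real A = ∫ x, (κ x).real A ∂μ := by
  rw [measureReal_def, Measure.bind_apply hA κ.measurable.aemeasurable]
  exact (integral_toReal (κ.measurable_coe hA).aemeasurable
    (.of_forall fun x => measure_lt_top (κ x) A)).symm

theorem exists_forall_abs_sub_le_of_osc {X : Type*} [Nonempty X] {φ W : X → ℝ}
    (h : ∀ x y, φ x - φ y ≤ W x + W y) : ∃ c, ∀ x, |φ x - c| ≤ W x := by
  have hb : ∀ y x, φ x - W x ≤ φ y + W y := fun y x => by linarith [h x y]
  refine ⟨⨆ x, (φ x - W x), fun x => ?_⟩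
  have hlower := le_ciSup (f := fun x => φ x - W x)
    ⟨φ x + W x, by rintro _ ⟨y, rfl⟩; exact hb x y⟩ x
  have hupper : ⨆ x, (φ x - W x) ≤ φ x + W x := ciSup_le (hb x)
  rw [abs_le]
  constructor <;> linarith

theorem integral_sub_integral_le_of_abs_le {μ ν : Measure X} [IsProbabilityMeasure μ]
    [IsProbabilityMeasure ν] {φ : X → ℝ} (hφ : Measurable φ) {r α : ℝ} (hr : 0 ≤ r)
    (h : ∀ x, |φ x| ≤ r) (hα : α ≤ μ.real {x | 0 ≤ φ x}ᶜ ∨ α ≤ ν.real {x | 0 ≤ φ x}) :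
    ∫ x, φ x ∂μ - ∫ x, φ x ∂ν ≤ r * (2 - α) := by
  set A := {x | 0 ≤ φ x}
  have hA : MeasurableSet A := measurableSet_le measurable_const hφ
  have hint : ∀ (ρ : Measure X) [IsProbabilityMeasure ρ], Integrable φ ρ := fun ρ _ =>
    .of_bound hφ.aestronglyMeasurable r (.of_forall h)
  have hupper : ∫ x, φ x ∂μ ≤ r * μ.real A := by
    rw [mul_comm, ← smul_eq_mul, ← integral_indicator_const r hA]
    refine integral_mono (hint μ) ((integrable_const r).indicator hA) fun x => ?_
    by_cases hx : x ∈ A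
    · simpa [hx] using (abs_le.1 (h x)).2
    · simpa [hx] using (not_le.1 hx).le
  have hlower : -(r * ν.real Aᶜ) ≤ ∫ x, φ x ∂ν := by
    rw [mul_comm, ← smul_eq_mul, ← integral_indicator_const r hA.compl, ← integral_neg]
    refine integral_mono ((integrable_const r).indicator hA.compl).neg (hint ν) fun x => ?_
    by_cases hx : x ∈ A
    · simpa [hx] using show 0 ≤ φ x from hx
    · simpa [hx] using (abs_le.1 (h x)).1
  have hsum : α ≤ (1 - μ.real A) + (1 - ν.real Aᶜ) := by
    rw [probReal_compl_eq_one_sub hA] at hα ⊢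
    have := measureReal_le_one (μ := μ) (s := A)
    have := measureReal_nonneg (μ := ν) (s := A)
    rcases hα with hα | hα <;> linarith
  nlinarith

/-- The hypotheses of Harris' theorem: a Lyapunov function `V` with a geometric drift, and a local
Dobrushin condition on the sublevel set `{V ≤ R}`, stated on sets: of a set and its complement,
one is charged by all transitions out of `{V ≤ R}`. -/
structure HarrisCondition (κ : Kernel X X) (V : X → ℝ) (lam b R α : ℝ) : Prop where
  measurable : Measurable V
  nonneg : ∀ x, 0 ≤ V x
  integrable : ∀ x, Integrable V (κ x)
  drift : ∀ x, ∫ y, V y ∂κ x ≤ lam * V x + b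
  lam_nonneg : 0 ≤ lam
  lam_lt_one : lam < 1
  b_nonneg : 0 ≤ b
  R_pos : 0 < R
  b_le : 4 * b ≤ (1 - lam) * R
  α_pos : 0 < α
  dichotomy : ∀ A, MeasurableSet A →
    (∀ x, V x ≤ R → α ≤ (κ x).real A) ∨ (∀ x, V x ≤ R → α ≤ (κ x).real Aᶜ)

theorem exists_harris_contraction_constants {lam b R α : ℝ} (hlam : 0 ≤ lam) (hlam1 : lam < 1)
    (hb : 0 ≤ b) (hR : 0 < R) (hbR : 4 * b ≤ (1 - lam) * R) (hα : 0 < α) :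
    ∃ β q : ℝ, 0 < β ∧ 0 ≤ q ∧ q < 1 ∧
      (∀ S, 0 ≤ S → 2 - α + β * (lam * S + 2 * b) ≤ q * (2 + β * S)) ∧
      ∀ S, R ≤ S → 2 + β * (lam * S + 2 * b) ≤ q * (2 + β * S) := by
  obtain ⟨β, hβ, hβb⟩ : ∃ β : ℝ, 0 < β ∧ 4 * (β * b) ≤ α := by
    refine ⟨α / (4 * b + 1), by positivity, ?_⟩
    rw [div_mul_eq_mul_div, mul_div_assoc', div_le_iff₀ (by positivity)]
    linarith
  have hβR : 0 < β * R := by positivity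
  set ρ := (1 + lam) / 2
  have hρ : 0 < ρ ∧ ρ < 1 := ⟨by simp only [ρ]; linarith, by simp only [ρ]; linarith⟩
  set q := max (max lam (1 - α / 4)) ((2 + β * R * ρ) / (2 + β * R))
  have hq_lam : lam ≤ q := (le_max_left _ _).trans (le_max_left _ _)
  have hq_α : 1 - α / 4 ≤ q := (le_max_right _ _).trans (le_max_left _ _)
  have hq_ρ : (2 + β * R * ρ) / (2 + β * R) ≤ q := le_max_right _ _
  refine ⟨β, q, hβ, hlam.trans hq_lam, max_lt (max_lt hlam1 (by linarith)) ?_,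
    fun S hS => ?_, fun S hS => ?_⟩
  · rw [div_lt_one (by positivity)]
    nlinarith
  · have : lam * (β * S) ≤ q * (β * S) := by gcongr
    linarith
  · have hS0 : 0 ≤ β * S := mul_nonneg hβ.le (hR.le.trans hS)
    have hmono : (2 + β * S * ρ) ≤ (2 + β * R * ρ) / (2 + β * R) * (2 + β * S) := by
      rw [div_mul_eq_mul_div, le_div_iff₀ (by positivity)]
      nlinarith [mul_nonneg hβ.le (mul_nonneg (sub_nonneg.2 hρ.2.le) (sub_nonneg.2 hS))]
    have hbS : β * (2 * b) ≤ β * ((1 - lam) / 2 * S) :=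
      mul_le_mul_of_nonneg_left (by nlinarith) hβ.le
    calc 2 + β * (lam * S + 2 * b) ≤ 2 + β * S * ρ := by simp only [ρ]; linarith
      _ ≤ _ := hmono
      _ ≤ q * (2 + β * S) := by gcongr

namespace HarrisCondition

variable {κ : Kernel X X} [IsMarkovKernel κ] {V : X → ℝ} {lam b R α : ℝ}

theorem abs_integral_le (H : HarrisCondition κ V lam b R α) {ψ : X → ℝ} {r s : ℝ}
    (hs : 0 ≤ s) (h : ∀ x, |ψ x| ≤ r + s * V x) (x : X) :
    |∫ z, ψ z ∂κ x| ≤ r + s * (lam * V x + b) := by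
  have hV := (H.integrable x).const_mul s
  calc |∫ z, ψ z ∂κ x| ≤ ∫ z, (r + s * V z) ∂κ x :=
        norm_integral_le_of_norm_le (f := ψ) (g := fun z => r + s * V z)
          ((integrable_const r).add hV) (.of_forall h)
    _ = r + s * ∫ z, V z ∂κ x := by
        rw [integral_add (integrable_const r) hV, integral_const_mul]; simp
    _ ≤ _ := by gcongr; exact H.drift x

theorem integral_sub_integral_le_of_add_le (H : HarrisCondition κ V lam b R α) {ψ : X → ℝ}
    (hψ : Measurable ψ) {r s : ℝ} (hr : 0 ≤ r) (hs : 0 ≤ s) (h : ∀ x, |ψ x| ≤ r + s * V x)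
    {x y : X} (hxy : V x + V y ≤ R) :
    ∫ z, ψ z ∂κ x - ∫ z, ψ z ∂κ y ≤ r * (2 - α) + s * (lam * (V x + V y) + 2 * b) := by
  set f : X → ℝ := fun z => max (-r) (min r (ψ z))
  have hf : Measurable f := by fun_prop
  have hf_le : ∀ z, |f z| ≤ r := fun z =>
    abs_le.2 ⟨le_max_left _ _, max_le (by linarith) (min_le_left _ _)⟩
  have htail : ∀ z, |ψ z - f z| ≤ 0 + s * V z := by
    intro z
    have hψz := abs_le.1 (h z)
    have hsV : 0 ≤ s * V z := mul_nonneg hs (H.nonneg z)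
    simp only [f, abs_le]
    rcases max_cases (-r) (min r (ψ z)) with hmax | hmax <;>
      rcases min_cases r (ψ z) with hmin | hmin <;> constructor <;> linarith
  have hsplit : ∀ w, ∫ z, ψ z ∂κ w = ∫ z, f z ∂κ w + ∫ z, (ψ z - f z) ∂κ w := fun w => by
    have hfi : Integrable f (κ w) := .of_bound hf.aestronglyMeasurable r (.of_forall hf_le)
    have hψi : Integrable ψ (κ w) :=
      ((integrable_const r).add ((H.integrable w).const_mul s)).mono'
        hψ.aestronglyMeasurable (.of_forall h)
    rw [integral_sub hψi hfi, add_sub_cancel]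
  have hhead : ∫ z, f z ∂κ x - ∫ z, f z ∂κ y ≤ r * (2 - α) := by
    refine integral_sub_integral_le_of_abs_le hf hr hf_le ?_
    have hx : V x ≤ R := by linarith [H.nonneg y]
    have hy : V y ≤ R := by linarith [H.nonneg x]
    exact (H.dichotomy _ (measurableSet_le measurable_const hf)).symm.imp (· x hx) (· y hy)
  rw [hsplit x, hsplit y]
  linarith [abs_le.1 (H.abs_integral_le hs htail x), abs_le.1 (H.abs_integral_le hs htail y)]

theorem exists_contraction [Nonempty X] (H : HarrisCondition κ V lam b R α) :
    ∃ β q : ℝ, 0 < β ∧ 0 ≤ q ∧ q < 1 ∧ ∀ (φ : X → ℝ) (r : ℝ), Measurable φ → 0 ≤ r →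
      (∀ x y, φ x - φ y ≤ r * (2 + β * (V x + V y))) →
      ∀ x y, ∫ z, φ z ∂κ x - ∫ z, φ z ∂κ y ≤ r * q * (2 + β * (V x + V y)) := by
  obtain ⟨β, q, hβ, hq, hq1, hsmall, hlarge⟩ :=
    exists_harris_contraction_constants H.lam_nonneg H.lam_lt_one H.b_nonneg H.R_pos H.b_le H.α_pos
  refine ⟨β, q, hβ, hq, hq1, fun φ r hφ hr hosc x y => ?_⟩
  have hrβ : 0 ≤ r * β := by positivity
  obtain ⟨c, hc⟩ := exists_forall_abs_sub_le_of_osc (φ := φ) (W := fun x => r + r * β * V x)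
    fun x y => (hosc x y).trans_eq (by ring)
  have hshift : ∀ w, ∫ z, φ z ∂κ w = ∫ z, (φ z - c) ∂κ w + c := fun w => by
    have hφc : Integrable (fun z => φ z - c) (κ w) :=
      ((integrable_const r).add ((H.integrable w).const_mul (r * β))).mono'
        (hφ.sub_const c).aestronglyMeasurable (.of_forall hc)
    simpa using integral_add hφc (integrable_const c)
  rw [hshift x, hshift y, add_sub_add_right_eq_sub, mul_assoc r]
  rcases le_total (V x + V y) R with hxy | hxy
  · calc _ ≤ r * (2 - α) + r * β * (lam * (V x + V y) + 2 * b) :=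
          H.integral_sub_integral_le_of_add_le (hφ.sub_const c) hr hrβ hc hxy
      _ = r * (2 - α + β * (lam * (V x + V y) + 2 * b)) := by ring
      _ ≤ _ := by gcongr; exact hsmall _ (add_nonneg (H.nonneg x) (H.nonneg y))
  · calc _ ≤ r * (2 + β * (lam * (V x + V y) + 2 * b)) := by
          linarith [abs_le.1 (H.abs_integral_le hrβ hc x), abs_le.1 (H.abs_integral_le hrβ hc y)]
      _ ≤ _ := by gcongr; exact hlarge _ hxy

theorem exists_geometric_bound [Nonempty X] (H : HarrisCondition κ V lam b R α) :
    ∃ β q : ℝ, 0 < β ∧ 0 ≤ q ∧ q < 1 ∧ ∀ n A, MeasurableSet A → ∀ x y,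
      |(kernelPow κ n x).real A - (kernelPow κ n y).real A| ≤ q ^ n * (2 + β * (V x + V y)) := by
  obtain ⟨β, q, hβ, hq, hq1, hcontr⟩ := H.exists_contraction
  suffices h : ∀ n A, MeasurableSet A → ∀ x y, (kernelPow κ n x).real A - (kernelPow κ n y).real A
      ≤ q ^ n * (2 + β * (V x + V y)) from
    ⟨β, q, hβ, hq, hq1, fun n A hA x y => abs_sub_le_iff.2
      ⟨h n A hA x y, by rw [add_comm (V x)]; exact h n A hA y x⟩⟩
  intro n A hA
  induction n with
  | zero =>
    intro x y
    have := mul_nonneg hβ.le (add_nonneg (H.nonneg x) (H.nonneg y))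
    linarith [measureReal_le_one (μ := kernelPow κ 0 x) (s := A),
      measureReal_nonneg (μ := kernelPow κ 0 y) (s := A)]
  | succ n ih =>
    intro x y
    simp only [kernelPow, Kernel.comp_apply, measureReal_bind_eq_integral hA, pow_succ]
    exact hcontr _ _ ((kernelPow κ n).measurable_coe hA).ennreal_toReal (by positivity) ih x y

theorem integrable_kernelPow_and_integral_le (H : HarrisCondition κ V lam b R α) (n : ℕ) (x : X) :
    Integrable V (kernelPow κ n x) ∧
      ∫ y, V y ∂(kernelPow κ n x) ≤ lam ^ n * V x + (1 - lam ^ n) * (b / (1 - lam)) := by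
  have hlam : 0 < 1 - lam := sub_pos.2 H.lam_lt_one
  induction n generalizing x with
  | zero =>
    rw [kernelPow, Kernel.id_apply, integral_dirac' _ _ H.measurable.stronglyMeasurable]
    exact ⟨integrable_dirac' H.measurable.stronglyMeasurable (by simp), by simp⟩
  | succ n ih =>
    set c := (1 - lam ^ n) * (b / (1 - lam)) with hc
    have hbound : Integrable (fun z => lam ^ n * V z + c) (κ x) :=
      ((H.integrable x).const_mul _).add (integrable_const _)
    have hmean : Integrable (fun z => ∫ y, V y ∂kernelPow κ n z) (κ x) :=
      hbound.mono' H.measurable.stronglyMeasurable.integral_kernel.aestronglyMeasurable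
        (.of_forall fun z => by
          rw [Real.norm_of_nonneg (integral_nonneg H.nonneg)]; exact (ih z).2)
    have hint : Integrable V ((kernelPow κ n ∘ₖ κ) x) := by
      refine (integrable_comp_iff H.measurable.aestronglyMeasurable).2
        ⟨.of_forall fun z => (ih z).1, ?_⟩
      simpa only [Real.norm_of_nonneg (H.nonneg _)] using hmean
    refine ⟨hint, ?_⟩
    calc ∫ y, V y ∂((kernelPow κ n ∘ₖ κ) x) = ∫ z, ∫ y, V y ∂kernelPow κ n z ∂κ x :=
          Kernel.integral_comp hint
      _ ≤ ∫ z, (lam ^ n * V z + c) ∂κ x := integral_mono hmean hbound fun z => (ih z).2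
      _ = lam ^ n * ∫ z, V z ∂κ x + c := by
          rw [integral_add ((H.integrable x).const_mul _) (integrable_const _),
            integral_const_mul]; simp
      _ ≤ lam ^ n * (lam * V x + b) + c := by
          gcongr
          exacts [pow_nonneg H.lam_nonneg n, H.drift x]
      _ = _ := by rw [hc, pow_succ]; field_simp; ring

end HarrisCondition

theorem integrable_and_integral_le_of_forall_integral_min_le {ν : Measure X} [IsFiniteMeasure ν]
    {V : X → ℝ} (hV : Measurable V) (hV0 : ∀ x, 0 ≤ V x) {D : ℝ}
    (h : ∀ N : ℕ, ∫ x, min (V x) N ∂ν ≤ D) : Integrable V ν ∧ ∫ x, V x ∂ν ≤ D := by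
  have hcover : AECover ν atTop fun N : ℕ => {x | V x ≤ N} :=
    ⟨.of_forall fun x => (tendsto_natCast_atTop_atTop (R := ℝ)).eventually_ge_atTop (V x),
      fun N => measurableSet_le hV measurable_const⟩
  have hmin : ∀ N : ℕ, Integrable (fun x => min (V x) N) ν := fun N =>
    .of_mem_Icc 0 N (hV.min measurable_const).aemeasurable
      (.of_forall fun x => ⟨le_min (hV0 x) N.cast_nonneg, min_le_right _ _⟩)
  have hEq : ∀ N : ℕ, Set.EqOn (fun x => min (V x) N) V {x | V x ≤ N} := fun N x hx =>
    min_eq_left hx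
  have hmeas : ∀ N : ℕ, MeasurableSet {x | V x ≤ N} := fun N => measurableSet_le hV measurable_const
  have hle : ∀ N : ℕ, ∫ x in {x | V x ≤ N}, V x ∂ν ≤ D := fun N => by
    rw [← setIntegral_congr_fun (hmeas N) (hEq N)]
    exact (setIntegral_le_integral (hmin N)
      (.of_forall fun x => le_min (hV0 x) N.cast_nonneg)).trans (h N)
  have hint : Integrable V ν := hcover.integrable_of_integral_bounded_of_nonneg_ae D
    (fun N => (hmin N).integrableOn.congr_fun (hEq N) (hmeas N)) (.of_forall hV0) (.of_forall hle)
  exact ⟨hint, le_of_tendsto' (hcover.integral_tendsto_of_countably_generated hint) hle⟩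

theorem abs_integral_sub_integral_le_of_forall_abs_sub_le {μ ν : Measure X}
    [IsProbabilityMeasure μ] [IsProbabilityMeasure ν] {g V : X → ℝ} {r s : ℝ}
    (hgμ : Integrable g μ) (hgν : Integrable g ν) (hVμ : Integrable V μ) (hVν : Integrable V ν)
    (h : ∀ x y, |g x - g y| ≤ r + s * (V x + V y)) :
    |∫ x, g x ∂μ - ∫ x, g x ∂ν| ≤ r + s * (∫ x, V x ∂μ + ∫ x, V x ∂ν) := by
  have hsum : Integrable (fun p : X × X => V p.1 + V p.2) (μ.prod ν) :=
    (hVμ.comp_fst ν).add (hVν.comp_snd μ)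
  calc |∫ x, g x ∂μ - ∫ x, g x ∂ν| = |∫ p, (g p.1 - g p.2) ∂μ.prod ν| := by
        rw [integral_sub (hgμ.comp_fst ν) (hgν.comp_snd μ), integral_fun_fst, integral_fun_snd]
        simp
    _ ≤ ∫ p, (r + s * (V p.1 + V p.2)) ∂μ.prod ν :=
        norm_integral_le_of_norm_le (f := fun p : X × X => g p.1 - g p.2)
          (g := fun p => r + s * (V p.1 + V p.2)) ((integrable_const r).add (hsum.const_mul s))
          (.of_forall fun p => h p.1 p.2)
    _ = _ := by
        rw [integral_add (integrable_const r) (hsum.const_mul s), integral_const_mul,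
          integral_add (hVμ.comp_fst ν) (hVν.comp_snd μ), integral_fun_fst, integral_fun_snd]
        simp

theorem integrable_measureReal_kernel (κ : Kernel X X) [IsMarkovKernel κ] (μ : Measure X)
    [IsFiniteMeasure μ] {A : Set X} (hA : MeasurableSet A) :
    Integrable (fun x => (κ x).real A) μ :=
  .of_mem_Icc 0 1 (κ.measurable_coe hA).ennreal_toReal.aemeasurable
    (.of_forall fun _ => ⟨measureReal_nonneg, measureReal_le_one⟩)

theorem integral_bind_kernel {W : Type*} [NormedAddCommGroup W] [NormedSpace ℝ W]
    {κ : Kernel X X} {μ : Measure X} {φ : X → W} (hφ : Integrable φ (μ.bind κ)) :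
    ∫ x, φ x ∂(μ.bind κ) = ∫ x, ∫ y, φ y ∂κ x ∂μ := by
  rw [Measure.comp_eq_comp_const_apply] at hφ ⊢
  rw [Kernel.integral_comp hφ, Kernel.const_apply]

theorem integral_kernel_of_invariant {W : Type*} [NormedAddCommGroup W] [NormedSpace ℝ W]
    {κ : Kernel X X} {ν : Measure X} (hν : Kernel.Invariant κ ν) {φ : X → W}
    (hφ : Integrable φ ν) :
    ∫ x, ∫ y, φ y ∂κ x ∂ν = ∫ x, φ x ∂ν := by
  rw [← integral_bind_kernel (hν.def.symm ▸ hφ), hν.def]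

theorem invariant_of_forall_abs_sub_measureReal_le {κ : Kernel X X} [IsMarkovKernel κ]
    {π : Measure X} [IsProbabilityMeasure π] {μ : ℕ → Measure X} [∀ n, IsProbabilityMeasure (μ n)]
    (hμ : ∀ n, μ (n + 1) = (μ n).bind κ) {ε : ℕ → ℝ} (hε : Tendsto ε atTop (𝓝 0))
    (h : ∀ n A, MeasurableSet A → |π.real A - (μ n).real A| ≤ ε n) : Kernel.Invariant κ π := by
  refine Measure.ext fun A hA => (measureReal_eq_measureReal_iff).1 ?_
  have hnext : ∀ n, |(μ (n + 1)).real A - (π.bind κ).real A| ≤ ε n := fun n => by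
    rw [hμ, measureReal_bind_eq_integral hA, measureReal_bind_eq_integral hA, abs_sub_comm]
    exact abs_integral_sub_integral_le_of_measureReal (h n)
      (κ.measurable_coe hA).ennreal_toReal fun _ => ⟨measureReal_nonneg, measureReal_le_one⟩
  have hlim : Tendsto (fun n => (μ n).real A) atTop (𝓝 (π.real A)) :=
    tendsto_iff_norm_sub_tendsto_zero.2 <|
      squeeze_zero (fun _ => norm_nonneg _) (fun n => by rw [norm_sub_rev]; exact h n A hA) hε
  have hlim' : Tendsto (fun n => (μ (n + 1)).real A) atTop (𝓝 ((π.bind κ).real A)) :=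
    tendsto_iff_norm_sub_tendsto_zero.2 <| squeeze_zero (fun _ => norm_nonneg _) hnext hε
  exact tendsto_nhds_unique hlim' ((tendsto_add_atTop_iff_nat 1).2 hlim)

theorem min_mul_add_mem_Icc {v c D N : ℝ} (hv : 0 ≤ v) (hc : 0 ≤ c) (hD : 0 ≤ D) (hN : 0 ≤ N) :
    min N (c * v + D) ∈ Set.Icc 0 N :=
  ⟨le_min hN (by positivity), min_le_left _ _⟩

theorem tendsto_integral_min_pow_mul_add {ν : Measure X} [IsProbabilityMeasure ν] {V : X → ℝ}
    (hV : Measurable V) (hV0 : ∀ x, 0 ≤ V x) {lam D N : ℝ} (hlam : 0 ≤ lam) (hlam1 : lam < 1)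
    (hD : 0 ≤ D) (hN : 0 ≤ N) :
    Tendsto (fun n => ∫ x, min N (lam ^ n * V x + D) ∂ν) atTop (𝓝 (min N D)) := by
  have hlim : Tendsto (fun n => ∫ x, min N (lam ^ n * V x + D) ∂ν) atTop
      (𝓝 (∫ _, min N D ∂ν)) := by
    refine tendsto_integral_of_dominated_convergence (fun _ => N)
      (fun n => (measurable_const.min ((hV.const_mul _).add_const D)).aestronglyMeasurable)
      (integrable_const _) (fun n => .of_forall fun x => ?_) (.of_forall fun x => ?_)
    · have hmem := min_mul_add_mem_Icc (hV0 x) (pow_nonneg hlam n) hD hN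
      rw [Real.norm_of_nonneg hmem.1]
      exact hmem.2
    · have hpow := tendsto_pow_atTop_nhds_zero_of_lt_one hlam hlam1
      simpa using tendsto_const_nhds.min ((hpow.mul_const (V x)).add_const D)
  simpa using hlim

namespace HarrisCondition

variable {κ : Kernel X X} [IsMarkovKernel κ] {V : X → ℝ} {lam b R α : ℝ}

theorem integrable_and_integral_le_of_invariant (H : HarrisCondition κ V lam b R α)
    {ν : Measure X} [IsProbabilityMeasure ν] (hν : Kernel.Invariant κ ν) :
    Integrable V ν ∧ ∫ x, V x ∂ν ≤ b / (1 - lam) := by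
  set D := b / (1 - lam)
  have hD : 0 ≤ D := div_nonneg H.b_nonneg (sub_pos.2 H.lam_lt_one).le
  refine integrable_and_integral_le_of_forall_integral_min_le H.measurable H.nonneg fun N => ?_
  set U : X → ℝ := fun x => min (V x) N
  have hU_mem : ∀ x, U x ∈ Set.Icc (0 : ℝ) N := fun x =>
    ⟨le_min (H.nonneg x) N.cast_nonneg, min_le_right _ _⟩
  have hU : ∀ (ρ : Measure X) [IsFiniteMeasure ρ], Integrable U ρ := fun ρ _ =>
    .of_mem_Icc 0 N (H.measurable.min measurable_const).aemeasurable (.of_forall hU_mem)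
  set g : ℕ → X → ℝ := fun n x => min (N : ℝ) (lam ^ n * V x + D)
  have hstep : ∀ n x, ∫ y, U y ∂(kernelPow κ n x) ≤ g n x := by
    intro n x
    obtain ⟨hVi, hVn⟩ := H.integrable_kernelPow_and_integral_le n x
    refine le_min ?_ ?_
    · simpa using integral_mono (hU (kernelPow κ n x)) (integrable_const (N : ℝ))
        fun y => (hU_mem y).2
    · have : 0 ≤ lam ^ n * D := mul_nonneg (pow_nonneg H.lam_nonneg n) hD
      linarith [integral_mono (hU (kernelPow κ n x)) hVi fun y => min_le_left (V y) N]
  have hg : ∀ n, Integrable (g n) ν := fun n =>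
    .of_mem_Icc 0 N (measurable_const.min ((H.measurable.const_mul _).add_const D)).aemeasurable
      (.of_forall fun x =>
        min_mul_add_mem_Icc (H.nonneg x) (pow_nonneg H.lam_nonneg n) hD N.cast_nonneg)
  have hbound : ∀ n, ∫ x, U x ∂ν ≤ ∫ x, g n x ∂ν := fun n => by
    rw [← integral_kernel_of_invariant (invariant_kernelPow hν n) (hU ν)]
    exact integral_mono_of_nonneg (.of_forall fun x => integral_nonneg fun y => (hU_mem y).1)
      (hg n) (.of_forall (hstep n))
  have hlim : Tendsto (fun n => ∫ x, g n x ∂ν) atTop (𝓝 (min N D)) :=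
    tendsto_integral_min_pow_mul_add H.measurable H.nonneg H.lam_nonneg H.lam_lt_one hD
      N.cast_nonneg
  exact (ge_of_tendsto' hlim hbound).trans (min_le_right _ _)

theorem exists_geometric_bound_bind [Nonempty X] (H : HarrisCondition κ V lam b R α) :
    ∃ β q : ℝ, 0 < β ∧ 0 ≤ q ∧ q < 1 ∧ ∀ (μ ν : Measure X) [IsProbabilityMeasure μ]
      [IsProbabilityMeasure ν], Integrable V μ → Integrable V ν → ∀ n A, MeasurableSet A →
      |(μ.bind (kernelPow κ n)).real A - (ν.bind (kernelPow κ n)).real A| ≤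
        q ^ n * (2 + β * (∫ x, V x ∂μ + ∫ x, V x ∂ν)) := by
  obtain ⟨β, q, hβ, hq, hq1, hgeom⟩ := H.exists_geometric_bound
  refine ⟨β, q, hβ, hq, hq1, fun μ ν _ _ hμ hν n A hA => ?_⟩
  rw [measureReal_bind_eq_integral hA, measureReal_bind_eq_integral hA, mul_add, ← mul_assoc]
  refine abs_integral_sub_integral_le_of_forall_abs_sub_le (integrable_measureReal_kernel _ _ hA)
    (integrable_measureReal_kernel _ _ hA) hμ hν fun x y => ?_
  simpa only [mul_add, mul_assoc] using hgeom n A hA x y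

theorem exists_invariant [Nonempty X] (H : HarrisCondition κ V lam b R α) :
    ∃ π : Measure X, IsProbabilityMeasure π ∧ Kernel.Invariant κ π := by
  obtain ⟨β, q, hβ, hq, hq1, hgeom⟩ := H.exists_geometric_bound_bind
  obtain ⟨x₀⟩ := ‹Nonempty X›
  have hadd : ∀ m n, kernelPow κ (m + n) x₀ = (kernelPow κ n x₀).bind (kernelPow κ m) :=
    fun m n => by rw [kernelPow_add, Kernel.comp_apply]
  set D := V x₀ + b / (1 - lam)
  have hmoment : ∀ k, ∫ x, V x ∂(kernelPow κ k x₀) ≤ D := fun k => by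
    have hD : 0 ≤ b / (1 - lam) := div_nonneg H.b_nonneg (sub_pos.2 H.lam_lt_one).le
    have hk0 := pow_nonneg H.lam_nonneg k
    have hk1 := pow_le_one₀ (n := k) H.lam_nonneg H.lam_lt_one.le
    exact (H.integrable_kernelPow_and_integral_le k x₀).2.trans <| add_le_add
      (mul_le_of_le_one_left (H.nonneg x₀) hk1) (mul_le_of_le_one_left hD (by linarith))
  have hε : Tendsto (fun n => q ^ n * (2 + β * (D + D))) atTop (𝓝 0) := by
    simpa using (tendsto_pow_atTop_nhds_zero_of_lt_one hq hq1).mul_const (2 + β * (D + D))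
  obtain ⟨π, hπ, hlim⟩ := exists_isProbabilityMeasure_of_uniformCauchy
    (μ := fun n => kernelPow κ n x₀) hε fun n k A hA => by
      rw [hadd, show kernelPow κ n x₀ = (kernelPow κ 0 x₀).bind (kernelPow κ n) from hadd n 0]
      refine (hgeom _ _ (H.integrable_kernelPow_and_integral_le k x₀).1
        (H.integrable_kernelPow_and_integral_le 0 x₀).1 n A hA).trans ?_
      gcongr
      exacts [hmoment k, hmoment 0]
  exact ⟨π, hπ, invariant_of_forall_abs_sub_measureReal_le
    (fun n => by rw [add_comm, hadd, kernelPow_one]) hε hlim⟩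

theorem eq_of_invariant (H : HarrisCondition κ V lam b R α) {μ ν : Measure X}
    [IsProbabilityMeasure μ] [IsProbabilityMeasure ν] (hμ : Kernel.Invariant κ μ)
    (hν : Kernel.Invariant κ ν) : μ = ν := by
  have : Nonempty X := nonempty_of_isProbabilityMeasure μ
  obtain ⟨β, q, -, hq, hq1, hgeom⟩ := H.exists_geometric_bound_bind
  have hlim : Tendsto (fun n => q ^ n * (2 + β * (∫ x, V x ∂μ + ∫ x, V x ∂ν))) atTop (𝓝 0) := by
    simpa using (tendsto_pow_atTop_nhds_zero_of_lt_one hq hq1).mul_const _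
  refine Measure.ext fun A hA => (measureReal_eq_measureReal_iff).1 <|
    eq_of_abs_sub_nonpos <| ge_of_tendsto' hlim fun n => ?_
  have h := hgeom μ ν (H.integrable_and_integral_le_of_invariant hμ).1
    (H.integrable_and_integral_le_of_invariant hν).1 n A hA
  rwa [(invariant_kernelPow hμ n).def, (invariant_kernelPow hν n).def] at h

end HarrisCondition

end Harris

section Minorization

open Filter

/- An essential infimum is attained along a countable subfamily. -/
theorem exists_measurable_pos_forall_ae_le {E ι : Type*} [MeasurableSpace E] (μ : Measure E)
    [SFinite μ] (C : Set ι) (p : ι → E → ℝ≥0∞) (hp : ∀ i ∈ C, Measurable (p i))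
    (hpos : ∀ v, 0 < ⨅ i ∈ C, p i v) :
    ∃ g : E → ℝ≥0∞, Measurable g ∧ (∀ v, 0 < g v) ∧ (∀ v, g v ≤ 1) ∧
      ∀ i ∈ C, g ≤ᵐ[μ] p i := by
  set G : Set ι → E → ℝ≥0∞ := fun S v => min 1 (⨅ i ∈ S, p i v)
  have hGm : ∀ S, S ⊆ C → S.Countable → Measurable (G S) := fun S hS hc =>
    measurable_const.min (Measurable.biInf S hc fun i hi => hp i (hS hi))
  have hGanti : ∀ S T, S ⊆ T → ∀ v, G T v ≤ G S v := fun S T h v =>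
    min_le_min_left _ (biInf_mono fun i hi => h hi)
  set Φ : Set ι → ℝ≥0∞ := fun S => ∫⁻ v, G S v ∂μ.toFinite
  set 𝒮 : Set ℝ≥0∞ := Φ '' {S | S ⊆ C ∧ S.Countable}
  have hne : 𝒮.Nonempty := ⟨Φ ∅, ∅, ⟨Set.empty_subset _, Set.countable_empty⟩, rfl⟩
  obtain ⟨u, -, hu, hmem⟩ := exists_seq_tendsto_sInf hne (OrderBot.bddBelow 𝒮)
  choose S hS hSu using hmem
  set T : Set ι := ⋃ n, S n
  have hTC : T ⊆ C := Set.iUnion_subset fun n => (hS n).1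
  have hTc : T.Countable := Set.countable_iUnion fun n => (hS n).2
  have hΦT : Φ T ≤ sInf 𝒮 := ge_of_tendsto' hu fun n => by
    rw [← hSu n]
    exact lintegral_mono (hGanti _ _ (Set.subset_iUnion S n))
  refine ⟨G T, hGm T hTC hTc, fun v => lt_min one_pos
    ((hpos v).trans_le (biInf_mono fun i hi => hTC hi)), fun v => min_le_left _ _, fun i hi => ?_⟩
  have hsub : insert i T ⊆ C := Set.insert_subset hi hTC
  have hle : Φ T ≤ Φ (insert i T) :=
    hΦT.trans (sInf_le ⟨_, ⟨hsub, hTc.insert i⟩, rfl⟩)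
  have hfin : Φ (insert i T) ≠ ∞ := by
    refine ne_top_of_le_ne_top ?_ (lintegral_mono (g := fun _ => 1) fun v => min_le_left _ _)
    simp
  have hae : G (insert i T) =ᵐ[μ.toFinite] G T :=
    ae_eq_of_ae_le_of_lintegral_le
      (Eventually.of_forall (hGanti _ _ (Set.subset_insert i T))) hfin
      (hGm T hTC hTc).aemeasurable hle
  filter_upwards [(absolutelyContinuous_toFinite μ).ae_le hae] with v hv
  rw [← hv]
  exact (min_le_right _ _).trans (biInf_le (fun i => p i v) (Set.mem_insert i T))

theorem exists_pos_le_withDensity {E : Type*} [MeasurableSpace E] {μ : Measure E} {g : E → ℝ≥0∞}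
    (hg : Measurable g) (hg0 : ∀ v, 0 < g v) (hg1 : ∀ v, g v ≤ 1) {B : Set E}
    (hBm : MeasurableSet B) (hB : μ B ≠ ∞) {q : ℝ≥0∞} (hq : q ≠ 0) :
    ∃ c : ℝ≥0∞, 0 < c ∧ ∀ A, MeasurableSet A → A ⊆ B → q ≤ μ A → c ≤ μ.withDensity g A := by
  have hfm : Measurable (B.indicator fun v => (g v)⁻¹) := hg.inv.indicator hBm
  have hmul : g * (B.indicator fun v => (g v)⁻¹) = B.indicator 1 := by
    funext v
    by_cases hv : v ∈ B
    · simp [hv, ENNReal.mul_inv_cancel (hg0 v).ne' ((hg1 v).trans_lt ENNReal.one_lt_top).ne]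
    · simp [hv]
  obtain ⟨c, hc, h⟩ := exists_pos_setLIntegral_lt_of_measure_lt (μ := μ.withDensity g)
    (f := B.indicator fun v => (g v)⁻¹) (by
      rw [lintegral_withDensity_eq_lintegral_mul _ hg hfm, hmul, lintegral_indicator_one hBm]
      exact hB) hq
  refine ⟨c, hc, fun A hA hAB hqA => ?_⟩
  by_contra! hlt
  have := h A hlt
  rw [setLIntegral_withDensity_eq_setLIntegral_mul _ hg hfm hA, hmul,
    lintegral_indicator_one hBm, Measure.restrict_apply hBm,
    Set.inter_eq_self_of_subset_right hAB] at this
  exact absurd hqA (not_le.2 this)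

theorem measure_norm_gt_mul_le_of_indepFun {Ω E : Type*} [MeasurableSpace Ω] {P : Measure Ω}
    [IsProbabilityMeasure P] [NormedAddCommGroup E] [MeasurableSpace E] [BorelSpace E]
    {a b U : Ω → E} (hind : IndepFun a b P) (hU : ∀ ω, U ω = a ω + b ω) {σ R : ℝ} (hR : 1 < R)
    (hint : Integrable (fun ω => ‖U ω‖ ^ 2) P) (hσ : ∫ ω, ‖U ω‖ ^ 2 ∂P ≤ σ ^ 2) :
    (R - 1) ^ 2 * (P.real {ω | ‖a ω‖ < 1} * P.real {ω | R < ‖b ω‖}) ≤ σ ^ 2 := by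
  have h1 : P.real {ω | ‖a ω‖ < 1} * P.real {ω | R < ‖b ω‖} =
      P.real ({ω | ‖a ω‖ < 1} ∩ {ω | R < ‖b ω‖}) := by
    rw [measureReal_def, measureReal_def, measureReal_def, ← ENNReal.toReal_mul]
    congr 1
    exact (hind.measure_inter_preimage_eq_mul {v | ‖v‖ < 1} {v | R < ‖v‖}
      (measurableSet_lt measurable_norm measurable_const)
      (measurableSet_lt measurable_const measurable_norm)).symm
  have h2 : {ω | ‖a ω‖ < 1} ∩ {ω | R < ‖b ω‖} ⊆ {ω | (R - 1) ^ 2 ≤ ‖U ω‖ ^ 2} := by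
    rintro ω ⟨ha, hb⟩
    have ha : ‖a ω‖ < 1 := ha
    have hb : R < ‖b ω‖ := hb
    have h3 : ‖b ω‖ ≤ ‖U ω‖ + ‖a ω‖ := by
      have : b ω = U ω - a ω := by rw [hU]; abel
      rw [this]; exact norm_sub_le _ _
    exact pow_le_pow_left₀ (sub_nonneg.2 hR.le) (by linarith : R - 1 ≤ ‖U ω‖) 2
  have h3 := mul_meas_ge_le_integral_of_nonneg (μ := P)
    (Eventually.of_forall fun ω => by positivity) hint ((R - 1) ^ 2)
  rw [h1]
  refine le_trans ?_ (h3.trans hσ)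
  exact mul_le_mul_of_nonneg_left (measureReal_mono h2) (by positivity)

theorem half_le_measureReal_norm_le_of_indepFun {Ω E : Type*} [MeasurableSpace Ω] {P : Measure Ω}
    [IsProbabilityMeasure P] [NormedAddCommGroup E] [MeasurableSpace E] [BorelSpace E]
    {a b U : Ω → E} (hb : Measurable b) (hind : IndepFun a b P) (hU : ∀ ω, U ω = a ω + b ω)
    {σ δ : ℝ} (hint : Integrable (fun ω => ‖U ω‖ ^ 2) P) (hσ : ∫ ω, ‖U ω‖ ^ 2 ∂P ≤ σ ^ 2)
    (hδ : 0 < δ) (ha : δ ≤ P.real {ω | ‖a ω‖ < 1}) :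
    1 / 2 ≤ P.real {ω | ‖b ω‖ ≤ 2 * σ ^ 2 / δ + 2} := by
  set r : ℝ := 2 * σ ^ 2 / δ + 1 with hr
  have hr1 : 1 ≤ r := le_add_of_nonneg_left (by positivity)
  have hcompl : {ω | ‖b ω‖ ≤ 2 * σ ^ 2 / δ + 2} = {ω | r + 1 < ‖b ω‖}ᶜ := by
    ext ω
    rw [Set.mem_compl_iff, Set.mem_ofPred_eq, Set.mem_ofPred_eq, not_lt, hr, add_assoc,
      one_add_one_eq_two]
  rw [hcompl, probReal_compl_eq_one_sub (measurableSet_lt measurable_const hb.norm)]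
  set y := P.real {ω | r + 1 < ‖b ω‖}
  have hy : 0 ≤ y := measureReal_nonneg
  have htail : r * δ * y ≤ σ ^ 2 := calc
    r * δ * y ≤ (r + 1 - 1) ^ 2 * (P.real {ω | ‖a ω‖ < 1} * y) := by
      rw [mul_assoc]
      gcongr
      nlinarith
    _ ≤ σ ^ 2 := measure_norm_gt_mul_le_of_indepFun hind hU (by linarith) hint hσ
  have hrδ : r * δ = 2 * σ ^ 2 + δ := by rw [hr]; field_simp
  by_contra! hlt
  nlinarith [sq_nonneg σ]

theorem mul_measure_preimage_le_of_indepFun {Ω α β : Type*} [MeasurableSpace Ω]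
    [MeasurableSpace α] [MeasurableSpace β] {P : Measure Ω} [IsFiniteMeasure P] {a : Ω → α}
    {b : Ω → β} (ha : Measurable a) (hb : Measurable b) (hind : IndepFun a b P) {S : Set (β × α)}
    (hS : MeasurableSet S) {T : Set β} (hT : MeasurableSet T) {c : ℝ≥0∞}
    (hc : ∀ u ∈ T, c ≤ P.map a {v | (u, v) ∈ S}) :
    c * P (b ⁻¹' T) ≤ P {ω | (b ω, a ω) ∈ S} := by
  have hlaw : P {ω | (b ω, a ω) ∈ S} = ((P.map b).prod (P.map a)) S := by
    rw [← (indepFun_iff_map_prod_eq_prod_map_map hb.aemeasurable ha.aemeasurable).1 hind.symm,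
      Measure.map_apply (hb.prodMk ha) hS, Set.preimage_ofPred_eq.symm, Set.ofPred_mem_eq]
  rw [hlaw, Measure.prod_apply hS]
  calc c * P (b ⁻¹' T) = ∫⁻ _ in T, c ∂P.map b := by
        rw [setLIntegral_const, Measure.map_apply hb hT]
    _ ≤ ∫⁻ u in T, P.map a (Prod.mk u ⁻¹' S) ∂P.map b := setLIntegral_mono' hT hc
    _ ≤ _ := setLIntegral_le_lintegral _ _

theorem half_measure_le_inter_or_compl_inter {X : Type*} [MeasurableSpace X] (μ : Measure X)
    {A : Set X} (hA : MeasurableSet A) (B : Set X) :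
    μ B / 2 ≤ μ (A ∩ B) ∨ μ B / 2 ≤ μ (Aᶜ ∩ B) := by
  by_contra! h
  have hsplit := measure_inter_add_sdiff (μ := μ) B hA
  rw [Set.inter_comm, Set.sdiff_eq, Set.inter_comm _ Aᶜ] at hsplit
  have hlt := ENNReal.add_lt_add h.1 h.2
  rw [hsplit, ENNReal.add_halves] at hlt
  exact lt_irrefl _ hlt

variable {E : Type*} [NormedAddCommGroup E] [NormedSpace ℝ E] [FiniteDimensional ℝ E]
  [MeasurableSpace E] [BorelSpace E]

theorem addHaar_preimage_sub_smul (μ : Measure E) [μ.IsAddHaarMeasure] {γ : ℝ} (hγ : γ ≠ 0)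
    (s : E) {A : Set E} (hA : MeasurableSet A) :
    μ {v | s - γ • v ∈ A} = ENNReal.ofReal |(γ ^ Module.finrank ℝ E)⁻¹| * μ A := by
  have h : {v | s - γ • v ∈ A} = (γ • ·) ⁻¹' ((fun v => s - v) ⁻¹' A) := rfl
  rw [h, Measure.addHaar_preimage_smul _ hγ,
    (Measure.measurePreserving_sub_left μ s).measure_preimage hA.nullMeasurableSet]

theorem exists_pos_le_withDensity_preimage_sub_smul (μ : Measure E) [μ.IsAddHaarMeasure]
    {g : E → ℝ≥0∞} (hg : Measurable g) (hg0 : ∀ v, 0 < g v) (hg1 : ∀ v, g v ≤ 1) {γ : ℝ}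
    (hγ : 0 < γ) (M : ℝ) :
    ∃ c : ℝ≥0∞, 0 < c ∧ ∀ A, MeasurableSet A →
      μ (Metric.ball 0 1) / 2 ≤ μ (A ∩ Metric.ball 0 1) → ∀ s : E, ‖s‖ ≤ M →
        c ≤ μ.withDensity g {v | s - γ • v ∈ A} := by
  set q : ℝ≥0∞ :=
    ENNReal.ofReal |(γ ^ Module.finrank ℝ E)⁻¹| * (μ (Metric.ball (0 : E) 1) / 2) with hq
  have hq0 : q ≠ 0 := by
    refine mul_ne_zero ?_ (ENNReal.half_pos (Metric.measure_ball_pos μ 0 one_pos).ne').ne'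
    rw [ne_eq, ENNReal.ofReal_eq_zero, not_le]
    positivity
  obtain ⟨c, hc, hcν⟩ := exists_pos_le_withDensity (μ := μ) hg hg0 hg1
    (measurableSet_closedBall (x := (0 : E)) (ε := (M + 1) / γ)) measure_closedBall_lt_top.ne hq0
  refine ⟨c, hc, fun A hA hAball s hs => ?_⟩
  have hinter : MeasurableSet (A ∩ Metric.ball 0 1) := hA.inter measurableSet_ball
  refine (hcν {v | s - γ • v ∈ A ∩ Metric.ball 0 1} ((by fun_prop : Measurable fun v : E =>
    s - γ • v) hinter) (fun v hv => ?_) ?_).trans (measure_mono fun v hv => hv.1)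
  · have hv1 : ‖s - γ • v‖ < 1 := mem_ball_zero_iff.1 hv.2
    rw [mem_closedBall_zero_iff, le_div_iff₀' hγ]
    calc γ * ‖v‖ = ‖s - (s - γ • v)‖ := by
          rw [sub_sub_cancel, norm_smul, Real.norm_of_nonneg hγ.le]
      _ ≤ ‖s‖ + ‖s - γ • v‖ := norm_sub_le _ _
      _ ≤ M + 1 := by gcongr
  · rw [addHaar_preimage_sub_smul μ hγ.ne' s hinter, hq]
    gcongr

theorem exists_pos_le_measureReal_norm_lt_one {Ω ι : Type*} [MeasurableSpace Ω]
    {P : Measure Ω} [IsFiniteMeasure P] (μ : Measure E) [μ.IsAddHaarMeasure] {C : Set ι}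
    {a : ι → Ω → E} (ha : ∀ x ∈ C, Measurable (a x)) {g : E → ℝ≥0∞} (hg : Measurable g)
    (hg0 : ∀ v, 0 < g v) (hg1 : ∀ v, g v ≤ 1) (hga : ∀ x ∈ C, μ.withDensity g ≤ P.map (a x)) :
    ∃ δ : ℝ, 0 < δ ∧ ∀ x ∈ C, δ ≤ P.real {ω | ‖a x ω‖ < 1} := by
  obtain ⟨δ, hδ, hδball⟩ := exists_pos_le_withDensity (μ := μ) hg hg0 hg1 measurableSet_ball
    measure_ball_lt_top.ne (Metric.measure_ball_pos μ (0 : E) one_pos).ne'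
  refine ⟨(min δ 1).toReal, ENNReal.toReal_pos (lt_min hδ one_pos).ne'
    (ne_top_of_le_ne_top ENNReal.one_ne_top (min_le_right _ _)), fun x hx =>
      ENNReal.toReal_mono (measure_ne_top P _) ((min_le_left _ _).trans ?_)⟩
  have h := (hδball _ measurableSet_ball subset_rfl le_rfl).trans (hga x hx _)
  rw [Measure.map_apply (ha x hx) measurableSet_ball] at h
  exact h.trans_eq (by simp only [ball_zero_eq, Set.preimage_ofPred_eq])

theorem mul_inv_two_le_measure_sub_smul_add {Ω : Type*} [MeasurableSpace Ω] {P : Measure Ω}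
    [IsFiniteMeasure P] {a b : Ω → E} (ha : Measurable a) (hb : Measurable b)
    (hind : IndepFun a b P) {R γ : ℝ} (hbR : 1 / 2 ≤ P.real {ω | ‖b ω‖ ≤ R}) (hγ : 0 < γ)
    {A : Set E} (hA : MeasurableSet A) {c : ℝ≥0∞} {s : E}
    (hc : ∀ s', ‖s'‖ ≤ ‖s‖ + γ * R → c ≤ P.map a {v | s' - γ • v ∈ A}) :
    c * 2⁻¹ ≤ P {ω | s - γ • (a ω + b ω) ∈ A} := by
  have hhalf : 2⁻¹ ≤ P (b ⁻¹' {u | ‖u‖ ≤ R}) := by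
    have h := ENNReal.ofReal_le_ofReal hbR
    rwa [ofReal_measureReal, one_div, ENNReal.ofReal_inv_of_pos two_pos,
      ENNReal.ofReal_ofNat] at h
  have hm : Measurable fun z : E × E => s - γ • z.1 - γ • z.2 := by fun_prop
  calc c * 2⁻¹ ≤ c * P (b ⁻¹' {u | ‖u‖ ≤ R}) := by gcongr
    _ ≤ P {ω | s - γ • b ω - γ • a ω ∈ A} :=
      mul_measure_preimage_le_of_indepFun ha hb hind (hm hA)
        (measurableSet_le measurable_norm measurable_const) fun u hu =>
          hc (s - γ • u) ((norm_sub_le s (γ • u)).trans (by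
            rw [norm_smul, Real.norm_of_nonneg hγ.le]
            gcongr
            exact hu))
    _ = P {ω | s - γ • (a ω + b ω) ∈ A} := by
      simp only [smul_add, add_comm (γ • a _), sub_sub]

/- The absolutely continuous part `a` of the noise charges every set that fills half of the unit
ball, uniformly over the bounded part of `b`; one of `A`, `Aᶜ` is such a set. -/
theorem exists_pos_forall_le_measureReal_or_compl {Ω ι : Type*} [MeasurableSpace Ω]
    {P : Measure Ω} [IsProbabilityMeasure P] (μ : Measure E) [μ.IsAddHaarMeasure] {C : Set ι}
    {a b U : ι → Ω → E} {p : ι → E → ℝ≥0∞} (ha : ∀ x ∈ C, Measurable (a x))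
    (hb : ∀ x ∈ C, Measurable (b x)) (hp : ∀ x ∈ C, Measurable (p x))
    (hU : ∀ x ∈ C, ∀ ω, U x ω = a x ω + b x ω) (hind : ∀ x ∈ C, IndepFun (a x) (b x) P)
    (hmap : ∀ x ∈ C, P.map (a x) = μ.withDensity (p x)) (hpos : ∀ v, 0 < ⨅ x ∈ C, p x v) {σ : ℝ}
    (hint : ∀ x ∈ C, Integrable (fun ω => ‖U x ω‖ ^ 2) P)
    (hσ : ∀ x ∈ C, ∫ ω, ‖U x ω‖ ^ 2 ∂P ≤ σ ^ 2) {s : ι → E} {M : ℝ}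
    (hs : ∀ x ∈ C, ‖s x‖ ≤ M) {γ : ℝ} (hγ : 0 < γ) :
    ∃ α : ℝ, 0 < α ∧ ∀ A, MeasurableSet A →
      (∀ x ∈ C, α ≤ P.real {ω | s x - γ • U x ω ∈ A}) ∨
      (∀ x ∈ C, α ≤ P.real {ω | s x - γ • U x ω ∈ Aᶜ}) := by
  obtain ⟨g, hg, hg0, hg1, hgp⟩ := exists_measurable_pos_forall_ae_le μ C p hp hpos
  have hga : ∀ x ∈ C, μ.withDensity g ≤ P.map (a x) := fun x hx => by
    rw [hmap x hx]; exact withDensity_mono (hgp x hx)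
  obtain ⟨δ, hδ, hδa⟩ := exists_pos_le_measureReal_norm_lt_one μ ha hg hg0 hg1 hga
  set R : ℝ := 2 * σ ^ 2 / δ + 2
  obtain ⟨c, hc, hcA⟩ := exists_pos_le_withDensity_preimage_sub_smul μ hg hg0 hg1 hγ (M + γ * R)
  have hcharge : ∀ A, MeasurableSet A → μ (Metric.ball 0 1) / 2 ≤ μ (A ∩ Metric.ball 0 1) →
      ∀ x ∈ C, (min (c * 2⁻¹) 1).toReal ≤ P.real {ω | s x - γ • U x ω ∈ A} :=
    fun A hA hAball x hx => by
      have hbR := half_le_measureReal_norm_le_of_indepFun (hb x hx) (hind x hx) (hU x hx)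
        (hint x hx) (hσ x hx) hδ (hδa x hx)
      simp only [hU x hx]
      exact ENNReal.toReal_mono (measure_ne_top P _) ((min_le_left _ _).trans
        (mul_inv_two_le_measure_sub_smul_add (ha x hx) (hb x hx) (hind x hx) hbR hγ hA
          fun s' hs' => (hcA A hA hAball s' (hs'.trans
            (add_le_add_left (hs x hx) _))).trans (hga x hx _)))
  exact ⟨(min (c * 2⁻¹) 1).toReal, ENNReal.toReal_pos
      (lt_min (ENNReal.mul_pos hc.ne' (by simp)) one_pos).ne'
      (ne_top_of_le_ne_top ENNReal.one_ne_top (min_le_right _ _)), fun A hA =>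
    (half_measure_le_inter_or_compl_inter μ hA (Metric.ball 0 1)).imp
      (hcharge A hA) (hcharge Aᶜ hA.compl)⟩

end Minorization

section Drift

open Filter

/-- A jointly measurable random field that at each point is centred, with fourth moment at most
`κ⁴`. -/
structure CenteredNoise {X Ω E : Type*} [MeasurableSpace X] [MeasurableSpace Ω]
    [NormedAddCommGroup E] [NormedSpace ℝ E] [MeasurableSpace E] (P : Measure Ω)
    (N : X → Ω → E) (κ : ℝ) : Prop where
  measurable : Measurable (fun p : X × Ω => N p.1 p.2)
  memLp_four : ∀ x, MemLp (N x) 4 P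
  integral_eq_zero : ∀ x, ∫ ω, N x ω ∂P = 0
  fourth_moment : ∀ x, ∫ ω, ‖N x ω‖ ^ 4 ∂P ≤ κ ^ 4

namespace CenteredNoise

variable {X Ω E : Type*} [MeasurableSpace X] [MeasurableSpace Ω] {P : Measure Ω}
  [IsProbabilityMeasure P] [NormedAddCommGroup E]

section NormedSpace

variable [NormedSpace ℝ E] [MeasurableSpace E] {N : X → Ω → E} {κ : ℝ}

theorem measurable_apply {P : Measure Ω} (hN : CenteredNoise P N κ) (x : X) : Measurable (N x) :=
  hN.measurable.comp measurable_prodMk_left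

theorem memLp_two (hN : CenteredNoise P N κ) (x : X) : MemLp (N x) 2 P :=
  (hN.memLp_four x).mono_exponent (by norm_num)

theorem integrable (hN : CenteredNoise P N κ) (x : X) : Integrable (N x) P :=
  (hN.memLp_four x).integrable (by norm_num)

theorem integrable_norm_sq (hN : CenteredNoise P N κ) (x : X) :
    Integrable (fun ω => ‖N x ω‖ ^ 2) P :=
  (hN.memLp_two x).integrable_norm_pow two_ne_zero

theorem integrable_norm_pow_four {P : Measure Ω} (hN : CenteredNoise P N κ) (x : X) :
    Integrable (fun ω => ‖N x ω‖ ^ 4) P :=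
  (hN.memLp_four x).integrable_norm_pow four_ne_zero

theorem integral_norm_sq_le (hN : CenteredNoise P N κ) (x : X) :
    ∫ ω, ‖N x ω‖ ^ 2 ∂P ≤ κ ^ 2 := by
  have hsq : MemLp (fun ω => ‖N x ω‖ ^ 2) 2 P := by
    rw [memLp_two_iff_integrable_sq (hN.integrable_norm_sq x).aestronglyMeasurable]
    simpa only [← pow_mul] using hN.integrable_norm_pow_four x
  have hvar := variance_eq_sub hsq
  have hnonneg := variance_nonneg (fun ω => ‖N x ω‖ ^ 2) P
  simp only [Pi.pow_apply, ← pow_mul] at hvar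
  refine le_of_sq_le_sq ?_ (sq_nonneg κ)
  linarith [hN.fourth_moment x, pow_mul κ 2 2]

end NormedSpace

end CenteredNoise

theorem norm_sub_smul_sq_le {E : Type*} [NormedAddCommGroup E] [InnerProductSpace ℝ E]
    {a f : E} {m γ L : ℝ} (hinner : m * ‖a‖ ^ 2 ≤ inner ℝ f a) (hf : ‖f‖ ≤ L * ‖a‖) (hγ : 0 ≤ γ)
    (hγL : γ * L ^ 2 ≤ m) : ‖a - γ • f‖ ^ 2 ≤ (1 - γ * m) * ‖a‖ ^ 2 := by
  have hsq : γ ^ 2 * ‖f‖ ^ 2 ≤ γ * m * ‖a‖ ^ 2 := calc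
    γ ^ 2 * ‖f‖ ^ 2 ≤ γ ^ 2 * (L * ‖a‖) ^ 2 := by gcongr
    _ = γ * (γ * L ^ 2) * ‖a‖ ^ 2 := by ring
    _ ≤ γ * m * ‖a‖ ^ 2 := by gcongr
  rw [norm_sub_sq_real, inner_smul_right, norm_smul, mul_pow, Real.norm_eq_abs, sq_abs,
    real_inner_comm]
  nlinarith

theorem norm_sub_smul_pow_four_le {E : Type*} [NormedAddCommGroup E] [InnerProductSpace ℝ E]
    (a u : E) (γ : ℝ) :
    ‖a - γ • u‖ ^ 4 ≤ ‖a‖ ^ 4 + 8 * γ ^ 2 * ‖a‖ ^ 2 * ‖u‖ ^ 2 + 3 * γ ^ 4 * ‖u‖ ^ 4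
      - 4 * γ * ‖a‖ ^ 2 * inner ℝ a u := by
  have hsq : ‖a - γ • u‖ ^ 2 = ‖a‖ ^ 2 - 2 * γ * inner ℝ a u + γ ^ 2 * ‖u‖ ^ 2 := by
    rw [norm_sub_sq_real, inner_smul_right, norm_smul, mul_pow, Real.norm_eq_abs, sq_abs]; ring
  have hcs : (inner ℝ a u) ^ 2 ≤ ‖a‖ ^ 2 * ‖u‖ ^ 2 := by
    rw [← mul_pow, ← sq_abs]
    exact pow_le_pow_left₀ (abs_nonneg _) (abs_real_inner_le_norm a u) 2
  rw [show ‖a - γ • u‖ ^ 4 = (‖a - γ • u‖ ^ 2) ^ 2 by ring, hsq]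
  nlinarith [sq_nonneg (γ * inner ℝ a u + γ ^ 2 * ‖u‖ ^ 2),
    mul_le_mul_of_nonneg_left hcs (sq_nonneg γ)]

section InnerProductSpace

variable {X Ω E : Type*} [MeasurableSpace X] [MeasurableSpace Ω] {P : Measure Ω}
  [IsProbabilityMeasure P] [NormedAddCommGroup E] [InnerProductSpace ℝ E] [MeasurableSpace E]
  {N : X → Ω → E} {κ : ℝ}

theorem CenteredNoise.integrable_norm_sub_smul_pow_four (hN : CenteredNoise P N κ) (x : X)
    (a : E) (γ : ℝ) : Integrable (fun ω => ‖a - γ • N x ω‖ ^ 4) P :=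
  ((memLp_const a).sub ((hN.memLp_four x).const_smul γ)).integrable_norm_pow four_ne_zero

theorem CenteredNoise.integral_norm_sub_smul_pow_four_le [CompleteSpace E]
    (hN : CenteredNoise P N κ) (x : X) (a : E) (γ : ℝ) :
    ∫ ω, ‖a - γ • N x ω‖ ^ 4 ∂P ≤
      ‖a‖ ^ 4 + 8 * γ ^ 2 * κ ^ 2 * ‖a‖ ^ 2 + 3 * γ ^ 4 * κ ^ 4 := by
  have hinner : ∫ ω, inner ℝ a (N x ω) ∂P = 0 := by
    rw [integral_inner (hN.integrable x), hN.integral_eq_zero, inner_zero_right]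
  have h2 := (hN.integrable_norm_sq x).const_mul (8 * γ ^ 2 * ‖a‖ ^ 2)
  have h4 := (hN.integrable_norm_pow_four x).const_mul (3 * γ ^ 4)
  have h1 := ((hN.integrable x).const_inner a).const_mul (4 * γ * ‖a‖ ^ 2)
  have h0 : Integrable (fun _ => ‖a‖ ^ 4) P := integrable_const _
  calc ∫ ω, ‖a - γ • N x ω‖ ^ 4 ∂P
      ≤ ∫ ω, (‖a‖ ^ 4 + 8 * γ ^ 2 * ‖a‖ ^ 2 * ‖N x ω‖ ^ 2 + 3 * γ ^ 4 * ‖N x ω‖ ^ 4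
          - 4 * γ * ‖a‖ ^ 2 * inner ℝ a (N x ω)) ∂P :=
        integral_mono (hN.integrable_norm_sub_smul_pow_four x a γ) (((h0.add h2).add h4).sub h1)
          fun ω => norm_sub_smul_pow_four_le a (N x ω) γ
    _ = ‖a‖ ^ 4 + 8 * γ ^ 2 * ‖a‖ ^ 2 * ∫ ω, ‖N x ω‖ ^ 2 ∂P
          + 3 * γ ^ 4 * ∫ ω, ‖N x ω‖ ^ 4 ∂P := by
      rw [integral_sub (by fun_prop) h1, integral_add (by fun_prop) h4, integral_add h0 h2,
        integral_const_mul, integral_const_mul, integral_const_mul, hinner, integral_const,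
        probReal_univ, one_smul, mul_zero, sub_zero]
    _ ≤ ‖a‖ ^ 4 + 8 * γ ^ 2 * ‖a‖ ^ 2 * κ ^ 2 + 3 * γ ^ 4 * κ ^ 4 := by
      gcongr
      exacts [hN.integral_norm_sq_le x, hN.fourth_moment x]
    _ = _ := by ring

end InnerProductSpace

variable {d : ℕ} {Ω : Type*} [MeasurableSpace Ω] {P : Measure Ω} [IsProbabilityMeasure P]
  {F : Eucl d → Eucl d} {N : Eucl d → Ω → Eucl d} {xs : Eucl d} {γ m κ : ℝ} {L : ℝ≥0}

theorem sgdaKernel_eq_map (hF : Measurable F)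
    (hN : Measurable (fun p : Eucl d × Ω => N p.1 p.2)) (γ : ℝ) (x : Eucl d) :
    sgdaKernel P F N γ x = P.map (fun ω => x - γ • (F x + N x ω)) := by
  refine Measure.ext fun B hB => ?_
  have hNx : Measurable (N x) := hN.comp measurable_prodMk_left
  rw [sgdaKernel_apply P F hF N hN γ x B hB, Measure.map_apply (by fun_prop) hB]
  rfl

theorem isMarkovKernel_sgdaKernel (hF : Measurable F)
    (hN : Measurable (fun p : Eucl d × Ω => N p.1 p.2)) (γ : ℝ) :
    IsMarkovKernel (sgdaKernel P F N γ) := by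
  refine ⟨fun x => ?_⟩
  have hNx : Measurable (N x) := hN.comp measurable_prodMk_left
  rw [sgdaKernel_eq_map hF hN]
  exact Measure.isProbabilityMeasure_map (by fun_prop)

theorem integral_norm_sgdaStep_sub_pow_four_le (hxs : F xs = 0) (hm : 0 < m)
    (hmono : WeakQuasiStronglyMonotone F xs m 0) (hF : LipschitzWith L F)
    (hN : CenteredNoise P N κ) (hγ : 0 ≤ γ) (hγ1 : γ ≤ 1) (hγL : γ * L ^ 2 ≤ m) (x : Eucl d) :
    ∫ ω, ‖x - γ • (F x + N x ω) - xs‖ ^ 4 ∂P ≤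
      (1 - γ * m / 2) * ‖x - xs‖ ^ 4 + γ ^ 3 * ((32 / m + 3) * κ ^ 4) := by
  have hstep : ∀ ω, x - γ • (F x + N x ω) - xs = ((x - xs) - γ • F x) - γ • N x ω := fun ω => by
    rw [smul_add]; abel
  simp only [hstep]
  refine (hN.integral_norm_sub_smul_pow_four_le x _ γ).trans ?_
  have hdrift : ‖(x - xs) - γ • F x‖ ^ 2 ≤ (1 - γ * m) * ‖x - xs‖ ^ 2 :=
    norm_sub_smul_sq_le (by simpa using hmono x) (by simpa [hxs] using hF.norm_sub_le x xs) hγ hγL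
  set A := ‖(x - xs) - γ • F x‖
  set Z := ‖x - xs‖
  have hAZ : A ^ 2 ≤ Z ^ 2 := hdrift.trans (by nlinarith [sq_nonneg Z, mul_nonneg hγ hm.le])
  have hquartic : A ^ 4 ≤ (1 - γ * m) * Z ^ 4 := calc
    A ^ 4 = A ^ 2 * A ^ 2 := by ring
    _ ≤ ((1 - γ * m) * Z ^ 2) * Z ^ 2 := by gcongr; exact (sq_nonneg A).trans hdrift
    _ = _ := by ring
  have hyoung : 8 * γ ^ 2 * κ ^ 2 * A ^ 2 ≤ γ * m / 2 * Z ^ 4 + 32 / m * γ ^ 3 * κ ^ 4 := by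
    have hsquare : γ * m / 2 * Z ^ 4 + 32 / m * γ ^ 3 * κ ^ 4 - 8 * γ ^ 2 * κ ^ 2 * Z ^ 2 =
        γ / (2 * m) * (m * Z ^ 2 - 8 * γ * κ ^ 2) ^ 2 := by field_simp; ring
    have hnonneg : 0 ≤ γ / (2 * m) * (m * Z ^ 2 - 8 * γ * κ ^ 2) ^ 2 := by positivity
    have hle : 8 * γ ^ 2 * κ ^ 2 * A ^ 2 ≤ 8 * γ ^ 2 * κ ^ 2 * Z ^ 2 := by gcongr
    linarith
  have hγ4 : 3 * γ ^ 4 * κ ^ 4 ≤ 3 * γ ^ 3 * κ ^ 4 := by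
    gcongr 3 * ?_ * κ ^ 4
    exact pow_le_pow_of_le_one hγ hγ1 (by norm_num)
  linarith

theorem PositiveDensityComponent.exists_pos_forall_le_sgdaKernel_or_compl
    (hdens : PositiveDensityComponent P fun _ : ℕ => N) (hF : LipschitzWith L F)
    (hN : CenteredNoise P N κ) (hγ : 0 < γ) {C : Set (Eucl d)} (hC : Bornology.IsBounded C) :
    ∃ α : ℝ, 0 < α ∧ ∀ A, MeasurableSet A →
      (∀ x ∈ C, α ≤ (sgdaKernel P F N γ x).real A) ∨
      (∀ x ∈ C, α ≤ (sgdaKernel P F N γ x).real Aᶜ) := by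
  obtain ⟨Ua, Ub, p, hp⟩ := hdens
  obtain ⟨hsplit, hpos⟩ := hp 0
  have hstep : LipschitzWith (1 + ‖γ‖₊ * L) fun x => x - γ • F x :=
    LipschitzWith.id.sub ((lipschitzWith_smul γ).comp hF)
  obtain ⟨M, hM⟩ := isBounded_iff_forall_norm_le.1 (hstep.isBounded_image hC)
  have hreal : ∀ x A, MeasurableSet A → (sgdaKernel P F N γ x).real A =
      P.real {ω | (x - γ • F x) - γ • N x ω ∈ A} := fun x A hA => by
    simp only [measureReal_def, sgdaKernel_apply P F hF.continuous.measurable _ hN.measurable γ x A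
      hA, smul_add, sub_sub]
  obtain ⟨α, hα, hdich⟩ := exists_pos_forall_le_measureReal_or_compl (P := P) volume (C := C)
    (fun x _ => (hsplit x).1) (fun x _ => (hsplit x).2.1) (fun x _ => (hsplit x).2.2.1)
    (fun x _ => (hsplit x).2.2.2.1) (fun x _ => (hsplit x).2.2.2.2.1)
    (fun x _ => (hsplit x).2.2.2.2.2) (hpos C hC) (fun x _ => hN.integrable_norm_sq x)
    (fun x _ => hN.integral_norm_sq_le x) (fun x hx => hM _ (Set.mem_image_of_mem _ hx)) hγ
  refine ⟨α, hα, fun A hA => (hdich A hA).imp ?_ ?_⟩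
  · exact fun h x hx => (h x hx).trans_eq (hreal x A hA).symm
  · exact fun h x hx => (h x hx).trans_eq (hreal x Aᶜ hA.compl).symm

theorem exists_harrisCondition_sgdaKernel (hxs : F xs = 0) (hm : 0 < m)
    (hmono : WeakQuasiStronglyMonotone F xs m 0) (hF : LipschitzWith L F)
    (hN : CenteredNoise P N κ) (hdens : PositiveDensityComponent P fun _ : ℕ => N) (hγ : 0 < γ)
    (hγ1 : γ ≤ 1) (hγm : γ * m ≤ 1) (hγL : γ * L ^ 2 ≤ m) :
    ∃ R α, HarrisCondition (sgdaKernel P F N γ) (fun x => ‖x - xs‖ ^ 4) (1 - γ * m / 2)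
      (γ ^ 3 * ((32 / m + 3) * κ ^ 4)) R α := by
  set b : ℝ := γ ^ 3 * ((32 / m + 3) * κ ^ 4)
  have hb : 0 ≤ b := by positivity
  set R : ℝ := 4 * b / (γ * m / 2) + 1 with hR
  have hbdd : Bornology.IsBounded {x : Eucl d | ‖x - xs‖ ^ 4 ≤ R} := by
    refine (Metric.isBounded_closedBall (x := xs) (r := max R 1)).subset fun x hx => ?_
    rw [mem_closedBall_iff_norm, le_max_iff, or_iff_not_imp_right, not_le]
    exact fun h1 => (le_self_pow₀ h1.le four_ne_zero).trans hx
  obtain ⟨α, hα, hdich⟩ := hdens.exists_pos_forall_le_sgdaKernel_or_compl hF hN hγ hbdd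
  have hFm : Measurable F := hF.continuous.measurable
  have hstep : ∀ x, Measurable fun ω => x - γ • (F x + N x ω) := fun x => by
    have := hN.measurable_apply x
    fun_prop
  have hV : Measurable fun x : Eucl d => ‖x - xs‖ ^ 4 := by fun_prop
  refine ⟨R, α, hV, fun x => by positivity, fun x => ?_, fun x => ?_, by linarith,
    sub_lt_self _ (by positivity), hb, by positivity, ?_, hα, hdich⟩
  · rw [sgdaKernel_eq_map hFm hN.measurable,
      integrable_map_measure hV.aestronglyMeasurable (hstep x).aemeasurable]
    refine (hN.integrable_norm_sub_smul_pow_four x ((x - xs) - γ • F x) γ).congr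
      (Eventually.of_forall fun ω => ?_)
    simp only [Function.comp_apply, smul_add]
    congr 2
    abel
  · rw [sgdaKernel_eq_map hFm hN.measurable,
      integral_map (hstep x).aemeasurable hV.aestronglyMeasurable]
    exact integral_norm_sgdaStep_sub_pow_four_le hxs hm hmono hF hN hγ.le hγ1 hγL x
  · rw [sub_sub_cancel, hR, mul_add, mul_div_cancel₀ _ (by positivity)]
    exact le_add_of_nonneg_right (by positivity)

end Drift

section Lyapunov

variable {E W : Type*} [NormedAddCommGroup E] [NormedSpace ℝ E] [NormedAddCommGroup W]
  [NormedSpace ℝ W]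

/-- The explicit Euler scheme `w ↦ w - s • D w` of the equation `w' = -D w` contracts for some
step `s`. This form of stability implies invertibility and passes to spaces of linear maps. -/
def EulerContracting (D : W →L[ℝ] W) : Prop :=
  ∃ s : ℝ, 0 < s ∧ ‖1 - s • D‖ < 1

theorem eulerContracting_of_forall_inner_le {E : Type*} [NormedAddCommGroup E]
    [InnerProductSpace ℝ E] {A : E →L[ℝ] E} {m : ℝ} (hm : 0 < m)
    (hA : ∀ h, m * ‖h‖ ^ 2 ≤ inner ℝ (A h) h) : EulerContracting A := by
  set s : ℝ := m / (‖A‖ ^ 2 + 1) with hs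
  have hs0 : 0 < s := by positivity
  have hsA : s * ‖A‖ ^ 2 ≤ m := by
    rw [hs, div_mul_eq_mul_div, div_le_iff₀ (by positivity)]
    gcongr
    exact le_add_of_nonneg_right zero_le_one
  refine ⟨s, hs0, (ContinuousLinearMap.opNorm_le_bound _ (Real.sqrt_nonneg (1 - s * m))
    fun h => ?_).trans_lt ((Real.sqrt_lt' one_pos).2 (by nlinarith [mul_pos hs0 hm]))⟩
  rw [← Real.sqrt_sq (norm_nonneg h), ← Real.sqrt_mul' _ (sq_nonneg _)]
  exact Real.le_sqrt_of_sq_le (norm_sub_smul_sq_le (hA h) (A.le_opNorm h) hs0.le hsA)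

theorem EulerContracting.surjective [CompleteSpace W] {D : W →L[ℝ] W} (hD : EulerContracting D) :
    Function.Surjective D := by
  obtain ⟨s, _, hlt⟩ := hD
  obtain ⟨u, hu⟩ : IsUnit (s • D) := by
    simpa only [sub_sub_cancel] using isUnit_one_sub_of_norm_lt_one hlt
  intro w
  refine ⟨s • (↑u⁻¹ : W →L[ℝ] W) w, ?_⟩
  rw [map_smul, ← smul_apply, ← hu]
  exact DFunLike.congr_fun u.mul_inv w

variable (W) in
/-- Precomposition with `A`, the Lyapunov operator on linear maps `E → W`. -/
noncomputable def precompOperator (A : E →L[ℝ] E) : (E →L[ℝ] W) →L[ℝ] E →L[ℝ] W :=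
  (ContinuousLinearMap.compL ℝ E E W).flip A

theorem precompOperator_apply (A : E →L[ℝ] E) (X : E →L[ℝ] W) (h : E) :
    precompOperator W A X h = X (A h) := rfl

/-- The operator `X ↦ X ∘ A + D ∘ X` on linear maps `E → W`. Iterating it on curried multilinear
maps sums, over the slots, the results of inserting `A` into one slot. -/
noncomputable def sylvesterOperator (A : E →L[ℝ] E) (D : W →L[ℝ] W) :
    (E →L[ℝ] W) →L[ℝ] E →L[ℝ] W :=
  precompOperator W A + ContinuousLinearMap.compL ℝ E W W D

theorem sylvesterOperator_apply (A : E →L[ℝ] E) (D : W →L[ℝ] W) (X : E →L[ℝ] W) (h : E) :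
    sylvesterOperator A D X h = X (A h) + D (X h) := rfl

theorem EulerContracting.precomp {A : E →L[ℝ] E} (hA : EulerContracting A) :
    EulerContracting (precompOperator W A) := by
  obtain ⟨s, hs, hlt⟩ := hA
  refine ⟨s, hs, lt_of_le_of_lt (ContinuousLinearMap.opNorm_le_bound _ (norm_nonneg _)
    fun X => ?_) hlt⟩
  have hcomp : (1 - s • precompOperator W A) X = X.comp (1 - s • A) := by
    ext h
    simp [precompOperator_apply]
  rw [hcomp, mul_comm]
  exact X.opNorm_comp_le _

theorem EulerContracting.exists_leftInverse [CompleteSpace E] {A : E →L[ℝ] E}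
    (hA : EulerContracting A) : ∃ Y : E →L[ℝ] E, Y ∘L A = .id ℝ E :=
  (hA.precomp (W := E)).surjective _

/- With `t = r s / (r + s)`, the Euler step of the sum is a convex combination of the Euler steps
of its two terms. -/
theorem EulerContracting.sylvester {A : E →L[ℝ] E} {D : W →L[ℝ] W}
    (hA : EulerContracting A) (hD : EulerContracting D) :
    EulerContracting (sylvesterOperator A D) := by
  obtain ⟨r, hr, hrA⟩ := hA
  obtain ⟨s, hs, hsD⟩ := hD
  refine ⟨r * s / (r + s), by positivity, lt_of_le_of_lt
    (ContinuousLinearMap.opNorm_le_bound _ (by positivity : 0 ≤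
      s / (r + s) * ‖1 - r • A‖ + r / (r + s) * ‖1 - s • D‖) fun X => ?_) ?_⟩
  · have hconv : (1 - (r * s / (r + s)) • sylvesterOperator A D) X =
        (s / (r + s)) • X.comp (1 - r • A) + (r / (r + s)) • (1 - s • D).comp X := by
      ext h
      simp only [sub_apply, one_apply_eq_self, smul_apply, add_apply,
        ContinuousLinearMap.comp_apply, sylvesterOperator_apply, map_sub, map_smul]
      match_scalars <;> field_simp
      ring
    rw [hconv, add_mul]
    refine (norm_add_le _ _).trans (add_le_add ?_ ?_)
    · rw [norm_smul, Real.norm_of_nonneg (by positivity), mul_assoc, mul_comm ‖1 - r • A‖]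
      gcongr
      exact X.opNorm_comp_le _
    · rw [norm_smul, Real.norm_of_nonneg (by positivity), mul_assoc]
      gcongr
      exact (1 - s • D).opNorm_comp_le _
  · calc s / (r + s) * ‖1 - r • A‖ + r / (r + s) * ‖1 - s • D‖
        < s / (r + s) * 1 + r / (r + s) * 1 := by gcongr
      _ = 1 := by field_simp; ring

end Lyapunov

section Taylor

open Asymptotics Filter Topology
open scoped Nat

variable {E H : Type*} [NormedAddCommGroup E] [NormedSpace ℝ E] [NormedAddCommGroup H]
  [NormedSpace ℝ H]

theorem isBigO_sub_taylor [CompleteSpace H] {n : ℕ} {f : E → H} (hf : ContDiff ℝ (n + 1) f)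
    (hbdd : ∃ K : ℝ, ∀ x, ‖iteratedFDeriv ℝ (n + 1) f x‖ ≤ K) (x₀ : E) :
    (fun x => f x - ∑ k ∈ Finset.range (n + 1),
        (k ! : ℝ)⁻¹ • iteratedFDeriv ℝ k f x₀ fun _ => x - x₀) =O[⊤]
      fun x => ‖x - x₀‖ ^ (n + 1) := by
  obtain ⟨K, hK⟩ := hbdd
  refine isBigO_top.2 ⟨(n ! : ℝ)⁻¹ * K, fun x => ?_⟩
  set h := x - x₀ with hh
  have htaylor := map_add_eq_sum_add_integral_iteratedFDeriv (x := x₀) (y := h) (n := n)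
    fun _ _ => hf.contDiffAt
  have hremainder : ‖∫ t in (0 : ℝ)..1,
      (1 - t) ^ n • iteratedFDeriv ℝ (n + 1) f (x₀ + t • h) fun _ => h‖ ≤
      K * ‖h‖ ^ (n + 1) * |1 - 0| := by
    refine intervalIntegral.norm_integral_le_of_norm_le_const fun t ht => ?_
    rw [Set.uIoc_of_le zero_le_one] at ht
    rw [norm_smul, norm_pow, Real.norm_of_nonneg (sub_nonneg.2 ht.2)]
    refine (mul_le_of_le_one_left (norm_nonneg _) (pow_le_one₀ (sub_nonneg.2 ht.2)
      (sub_le_self _ ht.1.le))).trans ?_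
    refine (ContinuousMultilinearMap.le_of_opNorm_le (hK _) fun _ => h).trans_eq ?_
    simp
  rw [hh, add_sub_cancel] at htaylor
  rw [htaylor, add_sub_cancel_left, norm_smul, Real.norm_of_nonneg (by positivity), mul_assoc]
  gcongr
  simpa [hh] using hremainder

theorem iteratedFDeriv_three_apply_const (f : E → H) (x h : E) :
    (iteratedFDeriv ℝ 3 f x fun _ => h) = fderiv ℝ (fderiv ℝ (fderiv ℝ f)) x h h h := by
  rw [iteratedFDeriv_succ_apply_right, iteratedFDeriv_two_apply]
  rfl

section Expansion

variable [CompleteSpace H] {f : E → H} (x₀ : E)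

theorem isBigO_sub_fderiv (hf : ContDiff ℝ 2 f)
    (hbdd : ∃ K : ℝ, ∀ x, ‖iteratedFDeriv ℝ 2 f x‖ ≤ K) :
    (fun x => f x - f x₀ - fderiv ℝ f x₀ (x - x₀)) =O[⊤] fun x => ‖x - x₀‖ ^ 2 := by
  simpa [Finset.sum_range_succ, sub_sub] using isBigO_sub_taylor (n := 1) hf hbdd x₀

theorem isBigO_sub_fderiv_two (hf : ContDiff ℝ 3 f)
    (hbdd : ∃ K : ℝ, ∀ x, ‖iteratedFDeriv ℝ 3 f x‖ ≤ K) :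
    (fun x => f x - f x₀ - fderiv ℝ f x₀ (x - x₀)
      - (2 : ℝ)⁻¹ • fderiv ℝ (fderiv ℝ f) x₀ (x - x₀) (x - x₀)) =O[⊤]
      fun x => ‖x - x₀‖ ^ 3 := by
  simpa [Finset.sum_range_succ, iteratedFDeriv_two_apply, sub_sub, add_assoc] using
    isBigO_sub_taylor (n := 2) hf hbdd x₀

theorem isBigO_sub_fderiv_three (hf : ContDiff ℝ 4 f)
    (hbdd : ∃ K : ℝ, ∀ x, ‖iteratedFDeriv ℝ 4 f x‖ ≤ K) :
    (fun x => f x - f x₀ - fderiv ℝ f x₀ (x - x₀)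
      - (2 : ℝ)⁻¹ • fderiv ℝ (fderiv ℝ f) x₀ (x - x₀) (x - x₀)
      - (6 : ℝ)⁻¹ • fderiv ℝ (fderiv ℝ (fderiv ℝ f)) x₀ (x - x₀) (x - x₀) (x - x₀)) =O[⊤]
      fun x => ‖x - x₀‖ ^ 4 := by
  simpa [Finset.sum_range_succ, iteratedFDeriv_two_apply, iteratedFDeriv_three_apply_const,
    sub_sub, add_assoc, Nat.factorial] using isBigO_sub_taylor (n := 3) hf hbdd x₀

end Expansion

theorem mul_norm_sq_le_inner_fderiv {E : Type*} [NormedAddCommGroup E] [InnerProductSpace ℝ E]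
    {F : E → E} {x₀ : E} {m : ℝ} (hzero : F x₀ = 0) (hF : DifferentiableAt ℝ F x₀)
    (hmono : ∀ x, m * ‖x - x₀‖ ^ 2 ≤ inner ℝ (F x) (x - x₀)) (h : E) :
    m * ‖h‖ ^ 2 ≤ inner ℝ (fderiv ℝ F x₀ h) h := by
  have hlim : Tendsto (fun t : ℝ => inner ℝ (t⁻¹ • F (x₀ + t • h)) h) (𝓝[>] 0)
      (𝓝 (inner ℝ (fderiv ℝ F x₀ h) h)) := by
    have hline : HasDerivAt (fun t : ℝ => F (x₀ + t • h)) (fderiv ℝ F x₀ h) 0 :=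
      hF.hasFDerivAt.hasLineDerivAt h
    have hslope := hline.tendsto_slope_zero_right
    simp only [zero_add, zero_smul, add_zero, hzero, sub_zero] at hslope
    exact hslope.inner tendsto_const_nhds
  refine ge_of_tendsto hlim (eventually_mem_nhdsWithin.mono fun t ht => ?_)
  have ht : 0 < t := ht
  have hmono_t := hmono (x₀ + t • h)
  rw [add_sub_cancel_left, norm_smul, inner_smul_right, Real.norm_of_nonneg ht.le] at hmono_t
  rw [real_inner_smul_left, le_inv_mul_iff₀ ht]
  nlinarith

end Taylor

section Moments

open Asymptotics Filter Set

/-- `f` is measurable with `‖f x‖ ≤ C * ‖x - x₀‖ ^ k` for some `C` and all `x`. For `k = 0` this is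
boundedness. -/
structure VanishesToOrder {E W : Type*} [NormedAddCommGroup E] [MeasurableSpace E]
    [NormedAddCommGroup W] (x₀ : E) (k : ℕ) (f : E → W) : Prop where
  stronglyMeasurable : StronglyMeasurable f
  isBigO : f =O[⊤] fun x => ‖x - x₀‖ ^ k

namespace VanishesToOrder

variable {E V W : Type*} [NormedAddCommGroup E] [MeasurableSpace E] [NormedAddCommGroup V]
  [NormedSpace ℝ V] [NormedAddCommGroup W] {x₀ : E} {k l : ℕ}

theorem sub_const [OpensMeasurableSpace E] [SecondCountableTopology E] (x₀ : E) :
    VanishesToOrder x₀ 1 fun x => x - x₀ :=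
  ⟨(continuous_id.sub continuous_const).stronglyMeasurable, by
    simpa using isBigO_norm_right.2 (isBigO_refl (fun x => x - x₀) ⊤)⟩

theorem of_forall_norm_le {f : E → W} (hf : StronglyMeasurable f) {c : ℝ} (hc : ∀ x, ‖f x‖ ≤ c) :
    VanishesToOrder x₀ 0 f :=
  ⟨hf, isBigO_top.2 ⟨c, fun x => by simpa using hc x⟩⟩

theorem add {f g : E → W} (hf : VanishesToOrder x₀ k f) (hg : VanishesToOrder x₀ k g) :
    VanishesToOrder x₀ k fun x => f x + g x :=
  ⟨hf.stronglyMeasurable.add hg.stronglyMeasurable, hf.isBigO.add hg.isBigO⟩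

theorem sub {f g : E → W} (hf : VanishesToOrder x₀ k f) (hg : VanishesToOrder x₀ k g) :
    VanishesToOrder x₀ k fun x => f x - g x :=
  ⟨hf.stronglyMeasurable.sub hg.stronglyMeasurable, hf.isBigO.sub hg.isBigO⟩

variable [NormedSpace ℝ W]

theorem clm_comp {f : E → V} (hf : VanishesToOrder x₀ k f) (B : V →L[ℝ] W) :
    VanishesToOrder x₀ k fun x => B (f x) :=
  ⟨B.continuous.comp_stronglyMeasurable hf.stronglyMeasurable,
    (B.isBigO_comp f ⊤).trans hf.isBigO⟩

theorem clm_apply {f : E → V →L[ℝ] W} {g : E → V} (hf : VanishesToOrder x₀ k f)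
    (hg : VanishesToOrder x₀ l g) : VanishesToOrder x₀ (k + l) fun x => f x (g x) where
  stronglyMeasurable := isBoundedBilinearMap_apply.continuous.comp_stronglyMeasurable
    (hf.stronglyMeasurable.prodMk hg.stronglyMeasurable)
  isBigO := by
    simp only [pow_add]
    exact (isBigO_of_le ⊤ fun x => by simpa using (f x).le_opNorm (g x)).trans
      (hf.isBigO.norm_left.mul hg.isBigO.norm_left)

theorem integral_isBigO {π : ℝ → Measure E} {s : Set ℝ} {f : E → W} (hf : VanishesToOrder x₀ k f)
    {g : E → ℝ} (hg : ∀ γ ∈ s, Integrable g (π γ)) (hle : ∀ x, ‖x - x₀‖ ^ k ≤ g x) :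
    (fun γ => ∫ x, f x ∂π γ) =O[𝓟 s] fun γ => ∫ x, g x ∂π γ := by
  obtain ⟨c, hc, hfc⟩ := hf.isBigO.exists_nonneg
  refine isBigO_principal.2 ⟨c, fun γ hγ => ?_⟩
  refine (norm_integral_le_of_norm_le ((hg γ hγ).const_mul c) (.of_forall fun x => ?_)).trans ?_
  · have hfx : ‖f x‖ ≤ c * ‖‖x - x₀‖ ^ k‖ := isBigOWith_top.1 hfc x
    rw [norm_pow, norm_norm] at hfx
    exact hfx.trans (mul_le_mul_of_nonneg_left (hle x) hc)
  · rw [integral_const_mul]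
    exact mul_le_mul_of_nonneg_left (Real.le_norm_self _) hc

end VanishesToOrder

theorem pow_le_pow_add_pow {x : ℝ} (hx : 0 ≤ x) {j k l : ℕ} (hjk : j ≤ k) (hkl : k ≤ l) :
    x ^ k ≤ x ^ j + x ^ l := by
  rcases le_total x 1 with h | h
  · exact (pow_le_pow_of_le_one hx h hjk).trans (le_add_of_nonneg_right (by positivity))
  · exact (pow_le_pow_right₀ h hkl).trans (le_add_of_nonneg_left (by positivity))

theorem isBigO_id_one (θ : ℝ) : (fun γ : ℝ => γ) =O[𝓟 (Ioo 0 θ)] fun _ => (1 : ℝ) :=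
  isBigO_principal.2 ⟨θ, fun γ hγ => by
    rw [Real.norm_of_nonneg hγ.1.le, norm_one, mul_one]
    exact hγ.2.le⟩

theorem isBigO_sq_id (θ : ℝ) : (fun γ : ℝ => γ ^ 2) =O[𝓟 (Ioo 0 θ)] fun γ => γ := by
  simpa only [sq, one_mul] using (isBigO_id_one θ).mul (isBigO_refl (fun γ : ℝ => γ) _)

theorem isBigO_principal_of_forall_eq {W : Type*} [NormedAddCommGroup W] {s : Set ℝ} {f f' : ℝ → W}
    {g : ℝ → ℝ} (hf : f =O[𝓟 s] g) (hff' : ∀ γ ∈ s, f' γ = f γ) : f' =O[𝓟 s] g :=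
  hf.congr' (eventually_principal.2 fun γ hγ => (hff' γ hγ).symm) .rfl

/-- The probability measures `π γ`, `0 < γ < θ`, concentrate at `x₀` at scale `√γ`, as measured by
their fourth moments. -/
structure QuarticConcentration {E : Type*} [NormedAddCommGroup E] [MeasurableSpace E]
    (π : ℝ → Measure E) (x₀ : E) (θ : ℝ) : Prop where
  isProbabilityMeasure : ∀ γ ∈ Ioo 0 θ, IsProbabilityMeasure (π γ)
  integrable_four : ∀ γ ∈ Ioo 0 θ, Integrable (fun x => ‖x - x₀‖ ^ 4) (π γ)
  isBigO_four : (fun γ => ∫ x, ‖x - x₀‖ ^ 4 ∂π γ) =O[𝓟 (Ioo 0 θ)] fun γ => γ ^ 2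

namespace QuarticConcentration

variable {E W : Type*} [NormedAddCommGroup E] [MeasurableSpace E] [NormedAddCommGroup W]
  {π : ℝ → Measure E} {x₀ : E} {θ γ : ℝ} {k : ℕ} {f : E → W}

theorem integral_isBigO_sq [NormedSpace ℝ W] (C : QuarticConcentration π x₀ θ)
    (hf : VanishesToOrder x₀ 4 f) : (fun γ => ∫ x, f x ∂π γ) =O[𝓟 (Ioo 0 θ)] fun γ => γ ^ 2 :=
  (hf.integral_isBigO C.integrable_four fun _ => le_rfl).trans C.isBigO_four

variable [OpensMeasurableSpace E]

theorem integrable_norm_pow (C : QuarticConcentration π x₀ θ) (hγ : γ ∈ Ioo 0 θ) (hk : k ≤ 4) :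
    Integrable (fun x => ‖x - x₀‖ ^ k) (π γ) := by
  have := C.isProbabilityMeasure γ hγ
  refine ((integrable_const (1 : ℝ)).add (C.integrable_four γ hγ)).mono'
    (by fun_prop : Continuous fun x => ‖x - x₀‖ ^ k).aestronglyMeasurable (.of_forall fun x => ?_)
  rw [norm_pow, norm_norm]
  simpa using pow_le_pow_add_pow (norm_nonneg (x - x₀)) (Nat.zero_le k) hk

theorem integrable (C : QuarticConcentration π x₀ θ) (hγ : γ ∈ Ioo 0 θ)
    (hf : VanishesToOrder x₀ k f) (hk : k ≤ 4) : Integrable f (π γ) := by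
  obtain ⟨c, hc⟩ := isBigO_top.1 hf.isBigO
  exact ((C.integrable_norm_pow hγ hk).const_mul c).mono'
    hf.stronglyMeasurable.aestronglyMeasurable (.of_forall fun x => by simpa using hc x)

theorem integrable_id [SecondCountableTopology E] (C : QuarticConcentration π x₀ θ)
    (hγ : γ ∈ Ioo 0 θ) : Integrable (fun x => x) (π γ) := by
  have := C.isProbabilityMeasure γ hγ
  simpa only [Pi.add_def, sub_add_cancel] using
    (C.integrable hγ (.sub_const x₀) (by norm_num)).add (integrable_const x₀)

theorem integral_norm_sq_isBigO (C : QuarticConcentration π x₀ θ) :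
    (fun γ => ∫ x, ‖x - x₀‖ ^ 2 ∂π γ) =O[𝓟 (Ioo 0 θ)] fun γ => γ := by
  obtain ⟨c, hc⟩ := isBigO_principal.1 C.isBigO_four
  refine isBigO_principal.2 ⟨1 + c, fun γ hγ => ?_⟩
  have := C.isProbabilityMeasure γ hγ
  have h4 := C.integrable_four γ hγ
  have hγ0 : 0 < γ := hγ.1
  have hyoung : ∀ x, ‖x - x₀‖ ^ 2 ≤ γ + γ⁻¹ * ‖x - x₀‖ ^ 4 := fun x => by
    rw [← sub_nonneg, show γ + γ⁻¹ * ‖x - x₀‖ ^ 4 - ‖x - x₀‖ ^ 2 =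
      γ⁻¹ * ((‖x - x₀‖ ^ 2 - γ / 2) ^ 2 + 3 / 4 * γ ^ 2) by field_simp; ring]
    positivity
  have hfour : ∫ x, ‖x - x₀‖ ^ 4 ∂π γ ≤ c * γ ^ 2 := by
    simpa using (le_abs_self _).trans (hc γ hγ)
  rw [Real.norm_of_nonneg (integral_nonneg fun _ => by positivity), Real.norm_of_nonneg hγ0.le]
  calc ∫ x, ‖x - x₀‖ ^ 2 ∂π γ
      ≤ ∫ x, (γ + γ⁻¹ * ‖x - x₀‖ ^ 4) ∂π γ :=
        integral_mono (C.integrable_norm_pow hγ (by norm_num))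
          ((integrable_const γ).add (h4.const_mul _)) hyoung
    _ = γ + γ⁻¹ * ∫ x, ‖x - x₀‖ ^ 4 ∂π γ := by
        rw [integral_add (integrable_const γ) (h4.const_mul _), integral_const_mul,
          integral_const, probReal_univ, one_smul]
    _ ≤ γ + γ⁻¹ * (c * γ ^ 2) := by gcongr
    _ = (1 + c) * γ := by field_simp

variable [NormedSpace ℝ W]

theorem integral_isBigO_id (C : QuarticConcentration π x₀ θ) (hf : VanishesToOrder x₀ k f)
    (hk2 : 2 ≤ k) (hk4 : k ≤ 4) : (fun γ => ∫ x, f x ∂π γ) =O[𝓟 (Ioo 0 θ)] fun γ => γ := by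
  have h2 := fun γ hγ => C.integrable_norm_pow (γ := γ) hγ (by norm_num : 2 ≤ 4)
  refine (hf.integral_isBigO (g := fun x => ‖x - x₀‖ ^ 2 + ‖x - x₀‖ ^ 4)
    (fun γ hγ => (h2 γ hγ).add (C.integrable_four γ hγ))
    fun x => pow_le_pow_add_pow (norm_nonneg _) hk2 hk4).trans ?_
  exact isBigO_principal_of_forall_eq
    (C.integral_norm_sq_isBigO.add (C.isBigO_four.trans (isBigO_sq_id θ)))
    fun γ hγ => integral_add (h2 γ hγ) (C.integrable_four γ hγ)

theorem integral_isBigO_one (C : QuarticConcentration π x₀ θ) (hf : VanishesToOrder x₀ k f)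
    (hk : k ≤ 4) : (fun γ => ∫ x, f x ∂π γ) =O[𝓟 (Ioo 0 θ)] fun _ => (1 : ℝ) := by
  have h0 := fun γ hγ => C.integrable_norm_pow (γ := γ) (k := 0) hγ (by norm_num)
  refine (hf.integral_isBigO (g := fun x => ‖x - x₀‖ ^ 0 + ‖x - x₀‖ ^ 4)
    (fun γ hγ => (h0 γ hγ).add (C.integrable_four γ hγ))
    fun x => pow_le_pow_add_pow (norm_nonneg _) k.zero_le hk).trans ?_
  refine isBigO_principal_of_forall_eq ((isBigO_refl (fun _ : ℝ => (1 : ℝ)) _).add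
    (C.isBigO_four.trans ((isBigO_sq_id θ).trans (isBigO_id_one θ)))) fun γ hγ => ?_
  have := C.isProbabilityMeasure γ hγ
  rw [integral_add (h0 γ hγ) (C.integrable_four γ hγ)]
  simp

end QuarticConcentration

end Moments

section NoiseMoments

set_option maxSynthPendingDepth 3

theorem integral_sub_smul_add_smul {X W : Type*} [MeasurableSpace X] {μ : Measure X}
    [NormedAddCommGroup W] [NormedSpace ℝ W] {f g k : X → W} (hf : Integrable f μ)
    (hg : Integrable g μ) (hk : Integrable k μ) (a b : ℝ) :
    ∫ x, (f x - a • g x + b • k x) ∂μ = ∫ x, f x ∂μ - a • ∫ x, g x ∂μ + b • ∫ x, k x ∂μ := by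
  have hg' : Integrable (fun x => a • g x) μ := hg.smul a
  have hk' : Integrable (fun x => b • k x) μ := hk.smul b
  have hfg : Integrable (fun x => f x - a • g x) μ := hf.sub hg'
  rw [integral_add hfg hk', integral_sub hf hg', integral_smul, integral_smul]

section Trilinear

variable {E W : Type*} [NormedAddCommGroup E] [NormedSpace ℝ E] [NormedAddCommGroup W]
  [NormedSpace ℝ W]

/-- The sum of the three bilinear maps obtained by filling one slot of the trilinear map `T`: the
polarization of `u ↦ T u u u`, up to a factor. -/
noncomputable def slotSum (T : E →L[ℝ] E →L[ℝ] E →L[ℝ] W) : E →L[ℝ] E →L[ℝ] E →L[ℝ] W :=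
  T + T.flip + ((ContinuousLinearMap.flipₗᵢ ℝ E E W : (E →L[ℝ] E →L[ℝ] W) →L[ℝ] _).comp T).flip

theorem slotSum_apply (T : E →L[ℝ] E →L[ℝ] E →L[ℝ] W) (a u v : E) :
    slotSum T a u v = T a u v + T u a v + T u v a := rfl

theorem EulerContracting.exists_bilinear_diag_eq [CompleteSpace W] {A : E →L[ℝ] E}
    (hA : EulerContracting A) (B : E →L[ℝ] E →L[ℝ] W) :
    ∃ B' : E →L[ℝ] E →L[ℝ] W, ∀ h, (B' + B'.flip) (A h) h = B h h := by
  obtain ⟨B', rfl⟩ := (hA.sylvester (hA.precomp (W := W))).surjective B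
  exact ⟨B', fun h => rfl⟩

theorem EulerContracting.exists_trilinear_diag_eq [CompleteSpace W] {A : E →L[ℝ] E}
    (hA : EulerContracting A) (T : E →L[ℝ] E →L[ℝ] E →L[ℝ] W) :
    ∃ T' : E →L[ℝ] E →L[ℝ] E →L[ℝ] W, ∀ h, slotSum T' (A h) h h = T h h h := by
  obtain ⟨T', rfl⟩ := (hA.sylvester (hA.sylvester (hA.precomp (W := W)))).surjective T
  exact ⟨T', fun h => add_assoc _ _ _⟩

theorem norm_trilinear_diag_le (T : E →L[ℝ] E →L[ℝ] E →L[ℝ] W) (v : E) :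
    ‖T v v v‖ ≤ ‖T‖ * ‖v‖ ^ 3 := calc
  ‖T v v v‖ ≤ ‖T v‖ * ‖v‖ * ‖v‖ := (T v).le_opNorm₂ v v
  _ ≤ ‖T‖ * ‖v‖ * ‖v‖ * ‖v‖ := by gcongr; exact T.le_opNorm v
  _ = ‖T‖ * ‖v‖ ^ 3 := by ring

theorem bilinear_sub_smul_diag (B : E →L[ℝ] E →L[ℝ] W) (u v : E) (γ : ℝ) :
    B (u - γ • v) (u - γ • v) = B u u - γ • (B + B.flip) v u + γ ^ 2 • B v v := by
  simp only [map_sub, map_smul, sub_apply, smul_apply, add_apply, ContinuousLinearMap.flip_apply]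
  module

theorem trilinear_sub_smul_diag (T : E →L[ℝ] E →L[ℝ] E →L[ℝ] W) (u v : E) (γ : ℝ) :
    T (u - γ • v) (u - γ • v) (u - γ • v) =
      T u u u - γ • slotSum T v u u + γ ^ 2 • slotSum T u v v - γ ^ 3 • T v v v := by
  simp only [map_sub, map_smul, sub_apply, smul_apply, slotSum_apply]
  module

end Trilinear

namespace CenteredNoise

variable {X Ω E W : Type*} [MeasurableSpace X] [MeasurableSpace Ω] {P : Measure Ω}
  [IsProbabilityMeasure P] [NormedAddCommGroup E] [NormedSpace ℝ E] [MeasurableSpace E]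
  [NormedAddCommGroup W] [NormedSpace ℝ W] {N : X → Ω → E} {κ : ℝ}

theorem integrable_bilinear (hN : CenteredNoise P N κ) (B : E →L[ℝ] E →L[ℝ] W) (x : X) :
    Integrable (fun ω => B (N x ω) (N x ω)) P := by
  refine ((hN.integrable_norm_sq x).const_mul ‖B‖).mono' ?_ (.of_forall fun ω => ?_)
  · exact (by fun_prop : Continuous fun v => B v v).comp_aestronglyMeasurable
      (hN.integrable x).aestronglyMeasurable
  · rw [sq, ← mul_assoc]
    exact B.le_opNorm₂ _ _

theorem integrable_norm_pow_three (hN : CenteredNoise P N κ) (x : X) :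
    Integrable (fun ω => ‖N x ω‖ ^ 3) P :=
  ((hN.memLp_four x).mono_exponent (by norm_num : (3 : ℝ≥0∞) ≤ 4)).integrable_norm_pow
    three_ne_zero

theorem integrable_trilinear (hN : CenteredNoise P N κ) (T : E →L[ℝ] E →L[ℝ] E →L[ℝ] W) (x : X) :
    Integrable (fun ω => T (N x ω) (N x ω) (N x ω)) P :=
  ((hN.integrable_norm_pow_three x).const_mul ‖T‖).mono'
    ((by fun_prop : Continuous fun v => T v v v).comp_aestronglyMeasurable
      (hN.integrable x).aestronglyMeasurable) (.of_forall fun _ => norm_trilinear_diag_le T _)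

theorem norm_integral_trilinear_le (hN : CenteredNoise P N κ) (T : E →L[ℝ] E →L[ℝ] E →L[ℝ] W)
    (x : X) : ‖∫ ω, T (N x ω) (N x ω) (N x ω) ∂P‖ ≤ ‖T‖ * (κ ^ 2 + κ ^ 4) := by
  have h2 := hN.integrable_norm_sq x
  have h4 := hN.integrable_norm_pow_four x
  have hcube : ∫ ω, ‖N x ω‖ ^ 3 ∂P ≤ κ ^ 2 + κ ^ 4 := calc
    ∫ ω, ‖N x ω‖ ^ 3 ∂P ≤ ∫ ω, (‖N x ω‖ ^ 2 + ‖N x ω‖ ^ 4) ∂P :=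
      integral_mono (hN.integrable_norm_pow_three x) (h2.add h4) fun ω =>
        pow_le_pow_add_pow (norm_nonneg _) (by norm_num) (by norm_num)
    _ = ∫ ω, ‖N x ω‖ ^ 2 ∂P + ∫ ω, ‖N x ω‖ ^ 4 ∂P := integral_add h2 h4
    _ ≤ κ ^ 2 + κ ^ 4 := add_le_add (hN.integral_norm_sq_le x) (hN.fourth_moment x)
  refine (norm_integral_le_of_norm_le ((hN.integrable_norm_pow_three x).const_mul ‖T‖)
    (.of_forall fun _ => norm_trilinear_diag_le T _)).trans ?_
  rw [integral_const_mul]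
  gcongr

section Complete

variable [CompleteSpace E] [CompleteSpace W]

theorem integral_clm_apply (hN : CenteredNoise P N κ) (Y : E →L[ℝ] W) (x : X) :
    ∫ ω, Y (N x ω) ∂P = 0 := by
  rw [Y.integral_comp_comm (hN.integrable x), hN.integral_eq_zero, map_zero]

theorem integral_bilinear_sub_smul (hN : CenteredNoise P N κ) (B : E →L[ℝ] E →L[ℝ] W) (x : X)
    (a : E) (γ : ℝ) : ∫ ω, B (a - γ • N x ω) (a - γ • N x ω) ∂P =
      B a a + γ ^ 2 • ∫ ω, B (N x ω) (N x ω) ∂P := by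
  set Y : E →L[ℝ] W := (B + B.flip).flip a
  have hexpand : ∀ ω, B (a - γ • N x ω) (a - γ • N x ω) =
      B a a - γ • Y (N x ω) + γ ^ 2 • B (N x ω) (N x ω) := fun _ => bilinear_sub_smul_diag B _ _ _
  simp only [hexpand]
  rw [integral_sub_smul_add_smul (integrable_const _) (Y.integrable_comp (hN.integrable x))
    (hN.integrable_bilinear B x), hN.integral_clm_apply, integral_const, probReal_univ, one_smul,
    smul_zero, sub_zero]

theorem integral_trilinear_sub_smul (hN : CenteredNoise P N κ) (T : E →L[ℝ] E →L[ℝ] E →L[ℝ] W)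
    (x : X) (a : E) (γ : ℝ) :
    ∫ ω, T (a - γ • N x ω) (a - γ • N x ω) (a - γ • N x ω) ∂P =
      T a a a + γ ^ 2 • ∫ ω, slotSum T a (N x ω) (N x ω) ∂P
        - γ ^ 3 • ∫ ω, T (N x ω) (N x ω) (N x ω) ∂P := by
  set Y : E →L[ℝ] W := ((slotSum T).flip a).flip a
  have h1 := Y.integrable_comp (hN.integrable x)
  have h2 := hN.integrable_bilinear (slotSum T a) x
  have h3 := hN.integrable_trilinear T x
  have hexpand : ∀ ω, T (a - γ • N x ω) (a - γ • N x ω) (a - γ • N x ω) =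
      T a a a - γ • Y (N x ω) + γ ^ 2 • slotSum T a (N x ω) (N x ω)
        - γ ^ 3 • T (N x ω) (N x ω) (N x ω) := fun _ => trilinear_sub_smul_diag T _ _ _
  simp only [hexpand]
  refine (integral_sub (((integrable_const _).sub (h1.smul γ)).add (h2.smul (γ ^ 2)))
    (h3.smul (γ ^ 3))).trans ?_
  rw [← integral_smul (γ ^ 3)]
  congr 1
  refine (integral_sub_smul_add_smul (integrable_const _) h1 h2 γ (γ ^ 2)).trans ?_
  rw [hN.integral_clm_apply, integral_const, probReal_univ, one_smul, smul_zero, sub_zero]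

end Complete

theorem vanishesToOrder_zero_integral_trilinear {N : E → Ω → E} [BorelSpace E]
    [SecondCountableTopology E] (hN : CenteredNoise P N κ)
    (T : E →L[ℝ] E →L[ℝ] E →L[ℝ] W) (x₀ : E) :
    VanishesToOrder x₀ 0 fun x => ∫ ω, T (N x ω) (N x ω) (N x ω) ∂P :=
  .of_forall_norm_le ((by fun_prop : Continuous fun v => T v v v).comp_stronglyMeasurable
    hN.measurable.stronglyMeasurable).integral_prod_right (hN.norm_integral_trilinear_le T)

end CenteredNoise

section Covariance

variable {d : ℕ} {Ω W : Type*} [MeasurableSpace Ω] {P : Measure Ω} [NormedAddCommGroup W]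
  [NormedSpace ℝ W] {N : Eucl d → Ω → Eucl d} {κ : ℝ}

variable (d W) in
/-- The contraction `∑ c i j • B eᵢ eⱼ` of a tensor with a bilinear map. -/
noncomputable def tensorPairing :
    (Fin d → Fin d → ℝ) →L[ℝ] (Eucl d →L[ℝ] Eucl d →L[ℝ] W) →L[ℝ] W :=
  ∑ i, ∑ j, ((ContinuousLinearMap.proj j : (Fin d → ℝ) →L[ℝ] ℝ).comp
    (ContinuousLinearMap.proj i : (Fin d → Fin d → ℝ) →L[ℝ] Fin d → ℝ)).smulRight
    ((ContinuousLinearMap.apply ℝ W (EuclideanSpace.single j (1 : ℝ))).comp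
      (ContinuousLinearMap.apply ℝ (Eucl d →L[ℝ] W) (EuclideanSpace.single i (1 : ℝ))))

theorem tensorPairing_apply (c : Fin d → Fin d → ℝ) (B : Eucl d →L[ℝ] Eucl d →L[ℝ] W) :
    tensorPairing d W c B =
      ∑ i, ∑ j, c i j • B (EuclideanSpace.single i 1) (EuclideanSpace.single j 1) := by
  simp [tensorPairing, sum_apply]

theorem tensorPairing_mul_self (v : Eucl d) (B : Eucl d →L[ℝ] Eucl d →L[ℝ] W) :
    tensorPairing d W (fun i j => v i * v j) B = B v v := by
  have hv : v = ∑ i, v i • EuclideanSpace.single i (1 : ℝ) := by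
    simpa using ((EuclideanSpace.basisFun (Fin d) ℝ).sum_repr v).symm
  conv_rhs => rw [hv]
  simp only [tensorPairing_apply, map_sum, map_smul, sum_apply, smul_apply,
    Finset.smul_sum, smul_smul]
  exact Finset.sum_comm.trans (by simp only [mul_comm])

variable [IsProbabilityMeasure P]

theorem CenteredNoise.integrable_apply_mul_apply (hN : CenteredNoise P N κ) (x : Eucl d)
    (i j : Fin d) : Integrable (fun ω => N x ω i * N x ω j) P :=
  ((hN.memLp_two x).eval_piLp i).integrable_mul ((hN.memLp_two x).eval_piLp j)

theorem CenteredNoise.integral_bilinear_eq_tensorPairing [CompleteSpace W]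
    (hN : CenteredNoise P N κ) (x : Eucl d) (B : Eucl d →L[ℝ] Eucl d →L[ℝ] W) :
    ∫ ω, B (N x ω) (N x ω) ∂P = tensorPairing d W (covTensor P N x) B := by
  simp only [← tensorPairing_mul_self _ B, tensorPairing_apply, covTensor]
  have hint := fun i j => (hN.integrable_apply_mul_apply x i j).smul_const
    (B (EuclideanSpace.single i 1) (EuclideanSpace.single j 1))
  rw [integral_finsetSum _ fun i _ => integrable_finsetSum _ fun j _ => hint i j]
  refine Finset.sum_congr rfl fun i _ => ?_
  rw [integral_finsetSum _ fun j _ => hint i j]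
  exact Finset.sum_congr rfl fun j _ => integral_smul_const _ _

theorem CenteredNoise.vanishesToOrder_zero_covTensor (hN : CenteredNoise P N κ) (x₀ : Eucl d) :
    VanishesToOrder x₀ 0 (covTensor P N) := by
  refine .of_forall_norm_le (c := κ ^ 2) ?_ fun x => ?_
  · refine (measurable_pi_lambda _ fun i => measurable_pi_lambda _ fun j => ?_).stronglyMeasurable
    have hcoord (k : Fin d) : Measurable fun p : Eucl d × Ω => N p.1 p.2 k :=
      (EuclideanSpace.proj k : Eucl d →L[ℝ] ℝ).measurable.comp hN.measurable
    exact ((hcoord i).mul (hcoord j)).stronglyMeasurable.integral_prod_right.measurable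
  · refine (pi_norm_le_iff_of_nonneg (sq_nonneg κ)).2 fun i =>
      (pi_norm_le_iff_of_nonneg (sq_nonneg κ)).2 fun j => ?_
    refine (norm_integral_le_of_norm_le (hN.integrable_norm_sq x)
      (.of_forall fun ω => ?_)).trans (hN.integral_norm_sq_le x)
    rw [norm_mul, sq]
    exact mul_le_mul (PiLp.norm_apply_le _ i) (PiLp.norm_apply_le _ j) (norm_nonneg _)
      (norm_nonneg _)

end Covariance

end NoiseMoments

section Stationary

set_option maxSynthPendingDepth 3

open Set

theorem integral_eq_smul_integral_of_expansion {X W : Type*} [MeasurableSpace X]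
    [NormedAddCommGroup W] [NormedSpace ℝ W] {μ : Measure X} {φ f g k : X → W} {γ : ℝ}
    (hf : Integrable f μ) (hg : Integrable g μ) (hk : Integrable k μ)
    (hγ : γ ≠ 0) (hφ : ∀ x, φ x = f x - γ • g x + γ ^ 2 • k x) (heq : ∫ x, φ x ∂μ = ∫ x, f x ∂μ) :
    ∫ x, g x ∂μ = γ • ∫ x, k x ∂μ := by
  simp only [hφ] at heq
  rw [integral_sub_smul_add_smul hf hg hk, sub_add, sub_eq_self, sub_eq_zero, sq, mul_smul] at heq
  exact smul_right_injective W hγ heq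

/-- For `0 < γ < θ` the law `π γ` is stationary for the step-size-`γ` iteration with drift `F` and
noise `N`, and these laws concentrate at a zero `x₀` of the drift as `γ → 0`. -/
structure StationaryFamily {d : ℕ} {Ω : Type*} [MeasurableSpace Ω] (P : Measure Ω)
    (F : Eucl d → Eucl d) (N : Eucl d → Ω → Eucl d) (π : ℝ → Measure (Eucl d)) (x₀ : Eucl d)
    (θ κ : ℝ) : Prop extends QuarticConcentration π x₀ θ where
  noise : CenteredNoise P N κ
  drift : VanishesToOrder x₀ 1 F
  invariant : ∀ γ ∈ Ioo 0 θ, Kernel.Invariant (sgdaKernel P F N γ) (π γ)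

namespace StationaryFamily

variable {d : ℕ} {Ω W : Type*} [MeasurableSpace Ω] {P : Measure Ω} [IsProbabilityMeasure P]
  [NormedAddCommGroup W] [NormedSpace ℝ W] {F : Eucl d → Eucl d} {N : Eucl d → Ω → Eucl d}
  {π : ℝ → Measure (Eucl d)} {x₀ : Eucl d} {θ κ γ : ℝ}

theorem integral_step (S : StationaryFamily P F N π x₀ θ κ) (hγ : γ ∈ Ioo 0 θ) {φ : Eucl d → W}
    (hφ : Continuous φ) (hint : Integrable (fun x => φ (x - x₀)) (π γ)) :
    ∫ x, ∫ ω, φ ((x - x₀ - γ • F x) - γ • N x ω) ∂P ∂π γ = ∫ x, φ (x - x₀) ∂π γ := by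
  have := S.isProbabilityMeasure γ hγ
  have hF : Measurable F := S.drift.stronglyMeasurable.measurable
  have := isMarkovKernel_sgdaKernel (P := P) hF S.noise.measurable γ
  rw [← integral_kernel_of_invariant (S.invariant γ hγ) hint]
  refine integral_congr_ae (.of_forall fun x => ?_)
  have hNx := S.noise.measurable_apply x
  beta_reduce
  have hφx : Continuous fun y => φ (y - x₀) := hφ.comp (continuous_sub_right x₀)
  rw [sgdaKernel_eq_map hF S.noise.measurable, integral_map (by fun_prop) hφx.aestronglyMeasurable]
  congr! 3 with ω
  rw [smul_add]
  abel

section Complete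

variable [CompleteSpace W]

theorem integral_drift_eq_zero (S : StationaryFamily P F N π x₀ θ κ) (hγ : γ ∈ Ioo 0 θ) :
    ∫ x, F x ∂π γ = 0 := by
  have := S.isProbabilityMeasure γ hγ
  have hh := S.integrable hγ (.sub_const x₀) (by norm_num)
  have hF : Integrable (fun x => γ • F x) (π γ) := (S.integrable hγ S.drift (by norm_num)).smul γ
  have hmean : ∀ x, ∫ ω, ((x - x₀ - γ • F x) - γ • N x ω) ∂P = x - x₀ - γ • F x := fun x => by
    have hN : Integrable (fun ω => γ • N x ω) P := (S.noise.integrable x).smul γ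
    rw [integral_sub (integrable_const _) hN, integral_smul, S.noise.integral_eq_zero,
      integral_const, probReal_univ, one_smul, smul_zero, sub_zero]
  have hstep := S.integral_step hγ continuous_id hh
  simp only [id_eq, hmean] at hstep
  rw [integral_sub hh hF, integral_smul, sub_eq_self] at hstep
  exact (smul_eq_zero.1 hstep).resolve_left hγ.1.ne'

theorem integral_bilinear_drift (S : StationaryFamily P F N π x₀ θ κ) (hγ : γ ∈ Ioo 0 θ)
    (B : Eucl d →L[ℝ] Eucl d →L[ℝ] W) :
    ∫ x, (B + B.flip) (F x) (x - x₀) ∂π γ =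
      γ • ∫ x, (B (F x) (F x) + tensorPairing d W (covTensor P N x) B) ∂π γ := by
  have hh := VanishesToOrder.sub_const x₀
  have hF := S.drift
  have hc := (S.noise.vanishesToOrder_zero_covTensor x₀).clm_comp ((tensorPairing d W).flip B)
  have i0 := S.integrable hγ ((hh.clm_comp B).clm_apply hh) (by norm_num)
  have i1 := S.integrable hγ ((hF.clm_comp (B + B.flip)).clm_apply hh) (by norm_num)
  have i2 := (S.integrable hγ ((hF.clm_comp B).clm_apply hF) (by norm_num)).add
    (S.integrable hγ hc (by norm_num))
  refine integral_eq_smul_integral_of_expansion i0 i1 i2 hγ.1.ne' (fun x => ?_)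
    (S.integral_step hγ (φ := fun h => B h h) (by fun_prop) i0)
  rw [S.noise.integral_bilinear_sub_smul, S.noise.integral_bilinear_eq_tensorPairing,
    bilinear_sub_smul_diag]
  module

theorem integral_trilinear_drift (S : StationaryFamily P F N π x₀ θ κ) (hγ : γ ∈ Ioo 0 θ)
    (T : Eucl d →L[ℝ] Eucl d →L[ℝ] Eucl d →L[ℝ] W) :
    ∫ x, slotSum T (F x) (x - x₀) (x - x₀) ∂π γ =
      γ • (∫ x, (slotSum T (x - x₀) (F x) (F x)
          + tensorPairing d W (covTensor P N x) (slotSum T (x - x₀))) ∂π γ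
        - γ • ∫ x, (T (F x) (F x) (F x) + tensorPairing d W (covTensor P N x) (slotSum T (F x))
          + ∫ ω, T (N x ω) (N x ω) (N x ω) ∂P) ∂π γ) := by
  have hh := VanishesToOrder.sub_const x₀
  have hF := S.drift
  have hc := (S.noise.vanishesToOrder_zero_covTensor x₀).clm_comp (tensorPairing d W)
  have i0 := S.integrable hγ (((hh.clm_comp T).clm_apply hh).clm_apply hh) (by norm_num)
  have i1 := S.integrable hγ (((hF.clm_comp (slotSum T)).clm_apply hh).clm_apply hh) (by norm_num)
  have i2 := (S.integrable hγ (((hh.clm_comp (slotSum T)).clm_apply hF).clm_apply hF)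
    (by norm_num)).add (S.integrable hγ (hc.clm_apply (hh.clm_comp (slotSum T))) (by norm_num))
  have i3 := ((S.integrable hγ (((hF.clm_comp T).clm_apply hF).clm_apply hF) (by norm_num)).add
    (S.integrable hγ (hc.clm_apply (hF.clm_comp (slotSum T))) (by norm_num))).add
    (S.integrable hγ (S.noise.vanishesToOrder_zero_integral_trilinear T x₀) (by norm_num))
  refine (integral_eq_smul_integral_of_expansion i0 i1 (i2.sub (i3.smul γ)) hγ.1.ne' (fun x => ?_)
    (S.integral_step hγ (φ := fun h => T h h h) (by fun_prop) i0)).trans ?_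
  · rw [S.noise.integral_trilinear_sub_smul, S.noise.integral_bilinear_eq_tensorPairing,
      trilinear_sub_smul_diag, map_sub (slotSum T) (x - x₀), map_smul,
      map_sub _ (slotSum T (x - x₀)), map_smul]
    simp only [Pi.add_apply, Pi.sub_apply, Pi.smul_apply]
    module
  · rw [integral_sub' i2 (i3.smul γ)]
    congr 2
    exact integral_smul γ _

end Complete

end StationaryFamily

end Stationary

section Expansion

set_option maxSynthPendingDepth 3

open Asymptotics Filter Set

namespace StationaryFamily

variable {d : ℕ} {Ω W : Type*} [MeasurableSpace Ω] {P : Measure Ω} [IsProbabilityMeasure P]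
  [NormedAddCommGroup W] [NormedSpace ℝ W] [CompleteSpace W] {F : Eucl d → Eucl d}
  {N : Eucl d → Ω → Eucl d} {π : ℝ → Measure (Eucl d)} {x₀ : Eucl d} {θ κ γ : ℝ}
  {A : Eucl d →L[ℝ] Eucl d}

theorem integral_sub_eq_of_leftInverse (S : StationaryFamily P F N π x₀ θ κ) (hγ : γ ∈ Ioo 0 θ)
    {Y : Eucl d →L[ℝ] Eucl d} (hY : Y ∘L A = .id ℝ (Eucl d)) :
    ∫ x, (x - x₀) ∂π γ = -Y (∫ x, (F x - A (x - x₀)) ∂π γ) := by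
  have hh := S.integrable hγ (.sub_const x₀) (by norm_num)
  rw [integral_sub (S.integrable hγ S.drift (by norm_num)) (A.integrable_comp hh),
    S.integral_drift_eq_zero hγ, zero_sub, map_neg, neg_neg, A.integral_comp_comm hh,
    ← ContinuousLinearMap.comp_apply, hY, ContinuousLinearMap.id_apply]

theorem integral_clm_isBigO_id (S : StationaryFamily P F N π x₀ θ κ) (hA : EulerContracting A)
    (hF : VanishesToOrder x₀ 2 fun x => F x - A (x - x₀)) (Z : Eucl d →L[ℝ] W) :
    (fun γ => ∫ x, Z (x - x₀) ∂π γ) =O[𝓟 (Ioo 0 θ)] fun γ => γ := by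
  obtain ⟨Y, hY⟩ := hA.exists_leftInverse
  have hrem := S.integral_isBigO_id hF le_rfl (by norm_num)
  refine isBigO_principal_of_forall_eq (((Z ∘L Y).isBigO_comp _ _).trans hrem).neg_left
    fun γ hγ => ?_
  rw [Z.integral_comp_comm (S.integrable hγ (.sub_const x₀) (by norm_num)),
    S.integral_sub_eq_of_leftInverse hγ hY, map_neg, ContinuousLinearMap.comp_apply]

theorem integral_tensorPairing_isBigO_id (S : StationaryFamily P F N π x₀ θ κ)
    (hA : EulerContracting A) (hF : VanishesToOrder x₀ 2 fun x => F x - A (x - x₀))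
    (hc : VanishesToOrder x₀ 1 fun x => covTensor P N x - covTensor P N x₀)
    (R : Eucl d →L[ℝ] Eucl d →L[ℝ] Eucl d →L[ℝ] W) :
    (fun γ => ∫ x, tensorPairing d W (covTensor P N x) (R (x - x₀)) ∂π γ)
      =O[𝓟 (Ioo 0 θ)] fun γ => γ := by
  have hh := VanishesToOrder.sub_const x₀
  have hrem := (hc.clm_comp (tensorPairing d W)).clm_apply (hh.clm_comp R)
  set Z : Eucl d →L[ℝ] W := tensorPairing d W (covTensor P N x₀) ∘L R with hZ
  refine isBigO_principal_of_forall_eq ((S.integral_clm_isBigO_id hA hF Z).add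
    (S.integral_isBigO_id hrem le_rfl (by norm_num))) fun γ hγ => ?_
  rw [← integral_add (S.integrable hγ (hh.clm_comp Z) (by norm_num))
    (S.integrable hγ hrem (by norm_num))]
  simp only [hZ, ContinuousLinearMap.comp_apply, map_sub (tensorPairing d W), sub_apply,
    add_sub_cancel]

theorem integral_trilinear_drift_isBigO_sq (S : StationaryFamily P F N π x₀ θ κ)
    (hA : EulerContracting A) (hF : VanishesToOrder x₀ 2 fun x => F x - A (x - x₀))
    (hc : VanishesToOrder x₀ 1 fun x => covTensor P N x - covTensor P N x₀)
    (T : Eucl d →L[ℝ] Eucl d →L[ℝ] Eucl d →L[ℝ] W) :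
    (fun γ => ∫ x, slotSum T (F x) (x - x₀) (x - x₀) ∂π γ) =O[𝓟 (Ioo 0 θ)] fun γ => γ ^ 2 := by
  have hh := VanishesToOrder.sub_const x₀
  have hD := S.drift
  have hcov := (S.noise.vanishesToOrder_zero_covTensor x₀).clm_comp (tensorPairing d W)
  have hcov_h := hcov.clm_apply (hh.clm_comp (slotSum T))
  have hcov_F := hcov.clm_apply (hD.clm_comp (slotSum T))
  have hhFF := ((hh.clm_comp (slotSum T)).clm_apply hD).clm_apply hD
  have hFFF := ((hD.clm_comp T).clm_apply hD).clm_apply hD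
  have hNNN := S.noise.vanishesToOrder_zero_integral_trilinear T x₀
  have hγ_id : (fun γ : ℝ => γ) =O[𝓟 (Ioo 0 θ)] fun γ => γ := isBigO_refl _ _
  have hfirst := (S.integral_isBigO_id hhFF (by norm_num) (by norm_num)).add
    (S.integral_tensorPairing_isBigO_id hA hF hc (slotSum T))
  have hsecond := ((S.integral_isBigO_one hFFF (by norm_num)).add
    (S.integral_isBigO_one hcov_F (by norm_num))).add (S.integral_isBigO_one hNNN (by norm_num))
  have htotal := hγ_id.smul (hfirst.sub ((hγ_id.smul hsecond).congr_right fun γ => mul_one γ))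
  refine isBigO_principal_of_forall_eq (htotal.congr_right fun γ => (sq γ).symm) fun γ hγ => ?_
  have iFFF := S.integrable hγ hFFF (by norm_num)
  have icov_F := S.integrable hγ hcov_F (by norm_num)
  rw [S.integral_trilinear_drift hγ, integral_add (S.integrable hγ hhFF (by norm_num))
    (S.integrable hγ hcov_h (by norm_num)), integral_add (iFFF.fun_add icov_F)
    (S.integrable hγ hNNN (by norm_num)), integral_add iFFF icov_F]

theorem integral_trilinear_isBigO_sq (S : StationaryFamily P F N π x₀ θ κ)
    (hA : EulerContracting A) (hF : VanishesToOrder x₀ 2 fun x => F x - A (x - x₀))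
    (hc : VanishesToOrder x₀ 1 fun x => covTensor P N x - covTensor P N x₀)
    (T : Eucl d →L[ℝ] Eucl d →L[ℝ] Eucl d →L[ℝ] W) :
    (fun γ => ∫ x, T (x - x₀) (x - x₀) (x - x₀) ∂π γ) =O[𝓟 (Ioo 0 θ)] fun γ => γ ^ 2 := by
  obtain ⟨T', hT'⟩ := hA.exists_trilinear_diag_eq T
  have hh := VanishesToOrder.sub_const x₀
  have hdrift := ((S.drift.clm_comp (slotSum T')).clm_apply hh).clm_apply hh
  have hrem := ((hF.clm_comp (slotSum T')).clm_apply hh).clm_apply hh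
  refine isBigO_principal_of_forall_eq ((S.integral_trilinear_drift_isBigO_sq hA hF hc T').sub
    (S.integral_isBigO_sq hrem)) fun γ hγ => ?_
  rw [← integral_sub (S.integrable hγ hdrift (by norm_num)) (S.integrable hγ hrem (by norm_num))]
  simp only [← hT', map_sub (slotSum T') (F _), sub_apply, sub_sub_cancel]

theorem exists_integral_bilinear_drift_sub_smul_isBigO_sq (S : StationaryFamily P F N π x₀ θ κ)
    (hA : EulerContracting A) {C : Eucl d →L[ℝ] Fin d → Fin d → ℝ}
    (hF : VanishesToOrder x₀ 2 fun x => F x - A (x - x₀))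
    (hc' : VanishesToOrder x₀ 2 fun x => covTensor P N x - covTensor P N x₀ - C (x - x₀))
    (B : Eucl d →L[ℝ] Eucl d →L[ℝ] W) :
    ∃ b : W, (fun γ => ∫ x, (B + B.flip) (F x) (x - x₀) ∂π γ - γ • b)
      =O[𝓟 (Ioo 0 θ)] fun γ => γ ^ 2 := by
  set p : (Fin d → Fin d → ℝ) →L[ℝ] W := (tensorPairing d W).flip B
  have hh := VanishesToOrder.sub_const x₀
  have hFF := (S.drift.clm_comp B).clm_apply S.drift
  have hlin := hh.clm_comp (p ∘L C)
  have hrem := hc'.clm_comp p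
  have hsum := ((S.integral_isBigO_id hFF le_rfl (by norm_num)).add
    (S.integral_clm_isBigO_id hA hF (p ∘L C))).add (S.integral_isBigO_id hrem le_rfl (by norm_num))
  refine ⟨p (covTensor P N x₀), isBigO_principal_of_forall_eq
    (((isBigO_refl (fun γ : ℝ => γ) _).smul hsum).congr_right fun γ => (sq γ).symm) fun γ hγ => ?_⟩
  have := S.isProbabilityMeasure γ hγ
  have iFF := S.integrable hγ hFF (by norm_num)
  have ilin := S.integrable hγ hlin (by norm_num)
  have irem := S.integrable hγ hrem (by norm_num)
  have hsplit (x : Eucl d) : tensorPairing d W (covTensor P N x) B = p (covTensor P N x₀)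
      + ((p ∘L C) (x - x₀) + p (covTensor P N x - covTensor P N x₀ - C (x - x₀))) := by
    rw [ContinuousLinearMap.comp_apply, ← map_add, ← map_add, add_sub_cancel, add_sub_cancel]
    rfl
  simp only [S.integral_bilinear_drift hγ, hsplit]
  rw [integral_add iFF ((integrable_const _).fun_add (ilin.fun_add irem)),
    integral_add (integrable_const _) (ilin.fun_add irem), integral_add ilin irem, integral_const,
    probReal_univ, one_smul]
  module

theorem exists_integral_bilinear_sub_smul_isBigO_sq (S : StationaryFamily P F N π x₀ θ κ)
    (hA : EulerContracting A) {Q : Eucl d →L[ℝ] Eucl d →L[ℝ] Eucl d}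
    {C : Eucl d →L[ℝ] Fin d → Fin d → ℝ}
    (hF : VanishesToOrder x₀ 2 fun x => F x - A (x - x₀))
    (hF' : VanishesToOrder x₀ 3 fun x => F x - A (x - x₀) - Q (x - x₀) (x - x₀))
    (hc : VanishesToOrder x₀ 1 fun x => covTensor P N x - covTensor P N x₀)
    (hc' : VanishesToOrder x₀ 2 fun x => covTensor P N x - covTensor P N x₀ - C (x - x₀))
    (B : Eucl d →L[ℝ] Eucl d →L[ℝ] W) :
    ∃ b : W, (fun γ => ∫ x, B (x - x₀) (x - x₀) ∂π γ - γ • b) =O[𝓟 (Ioo 0 θ)] fun γ => γ ^ 2 := by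
  obtain ⟨B', hB'⟩ := hA.exists_bilinear_diag_eq B
  obtain ⟨b, hb⟩ := S.exists_integral_bilinear_drift_sub_smul_isBigO_sq hA hF hc' B'
  set R := B' + B'.flip
  set T := (ContinuousLinearMap.compL ℝ (Eucl d) (Eucl d) (Eucl d →L[ℝ] W) R) ∘L Q
  have hh := VanishesToOrder.sub_const x₀
  have hcubic := ((hh.clm_comp T).clm_apply hh).clm_apply hh
  have hrem := (hF'.clm_comp R).clm_apply hh
  refine ⟨b, isBigO_principal_of_forall_eq ((hb.sub (S.integral_trilinear_isBigO_sq hA hF hc T)).sub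
    (S.integral_isBigO_sq hrem)) fun γ hγ => ?_⟩
  have iquad := S.integrable hγ ((hF.clm_comp R).clm_apply hh) (by norm_num)
  have hlower : ∫ x, B (x - x₀) (x - x₀) ∂π γ = ∫ x, R (F x) (x - x₀) ∂π γ
      - ∫ x, R (F x - A (x - x₀)) (x - x₀) ∂π γ := by
    rw [← integral_sub (S.integrable hγ ((S.drift.clm_comp R).clm_apply hh) (by norm_num)) iquad]
    simp only [← hB', map_sub R (F _), sub_apply, sub_sub_cancel]
  have hquad : ∫ x, R (F x - A (x - x₀) - Q (x - x₀) (x - x₀)) (x - x₀) ∂π γ =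
      ∫ x, R (F x - A (x - x₀)) (x - x₀) ∂π γ - ∫ x, T (x - x₀) (x - x₀) (x - x₀) ∂π γ := by
    rw [← integral_sub iquad (S.integrable hγ hcubic (by norm_num))]
    simp only [map_sub R (F _ - _), sub_apply]
    rfl
  rw [hlower, hquad]
  abel

theorem exists_integral_sub_sub_smul_isBigO_sq (S : StationaryFamily P F N π x₀ θ κ)
    (hA : EulerContracting A) {Q : Eucl d →L[ℝ] Eucl d →L[ℝ] Eucl d}
    {T : Eucl d →L[ℝ] Eucl d →L[ℝ] Eucl d →L[ℝ] Eucl d} {C : Eucl d →L[ℝ] Fin d → Fin d → ℝ}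
    (hF : VanishesToOrder x₀ 2 fun x => F x - A (x - x₀))
    (hF' : VanishesToOrder x₀ 3 fun x => F x - A (x - x₀) - Q (x - x₀) (x - x₀))
    (hF'' : VanishesToOrder x₀ 4 fun x =>
      F x - A (x - x₀) - Q (x - x₀) (x - x₀) - T (x - x₀) (x - x₀) (x - x₀))
    (hc : VanishesToOrder x₀ 1 fun x => covTensor P N x - covTensor P N x₀)
    (hc' : VanishesToOrder x₀ 2 fun x => covTensor P N x - covTensor P N x₀ - C (x - x₀)) :
    ∃ Δ, (fun γ => ∫ x, (x - x₀) ∂π γ - γ • Δ) =O[𝓟 (Ioo 0 θ)] fun γ => γ ^ 2 := by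
  obtain ⟨Y, hY⟩ := hA.exists_leftInverse
  obtain ⟨b, hb⟩ := S.exists_integral_bilinear_sub_smul_isBigO_sq hA hF hF' hc hc' Q
  have hh := VanishesToOrder.sub_const x₀
  have hcubic := S.integral_trilinear_isBigO_sq hA hF hc T
  refine ⟨-Y b, isBigO_principal_of_forall_eq ((Y.isBigO_comp _ _).trans
    ((hb.add hcubic).add (S.integral_isBigO_sq hF''))).neg_left fun γ hγ => ?_⟩
  have hquad := S.integrable hγ ((hh.clm_comp Q).clm_apply hh) (by norm_num)
  have hsplit : ∫ x, (F x - A (x - x₀)) ∂π γ = ∫ x, Q (x - x₀) (x - x₀) ∂π γ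
      + ∫ x, T (x - x₀) (x - x₀) (x - x₀) ∂π γ
      + ∫ x, (F x - A (x - x₀) - Q (x - x₀) (x - x₀) - T (x - x₀) (x - x₀) (x - x₀)) ∂π γ := by
    rw [integral_sub (S.integrable hγ hF' (by norm_num)) (S.integrable hγ
      (((hh.clm_comp T).clm_apply hh).clm_apply hh) (by norm_num)),
      integral_sub (S.integrable hγ hF (by norm_num)) hquad]
    abel
  rw [S.integral_sub_eq_of_leftInverse hγ hY, hsplit]
  simp only [map_add, map_sub, map_smul, smul_neg]
  abel

end StationaryFamily

end Expansion

section Main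

open Asymptotics Filter Set Topology

variable {d : ℕ} {Ω : Type*} [MeasurableSpace Ω] {P : Measure Ω}
  {F : Eucl d → Eucl d} {N : Eucl d → Ω → Eucl d} {U : ℕ → Eucl d → Ω → Eucl d} {xs : Eucl d}
  {m σ κ G θ : ℝ} {L : ℝ≥0}

theorem PositiveDensityComponent.const (hdens : PositiveDensityComponent P U) (t : ℕ) :
    PositiveDensityComponent P fun _ : ℕ => U t :=
  let ⟨Ua, Ub, p, hp⟩ := hdens
  ⟨fun _ => Ua t, fun _ => Ub t, fun _ => p t, fun _ => hp t⟩

variable [IsProbabilityMeasure P]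

theorem exists_stationaryFamily (hxs : F xs = 0) (hm : 0 < m)
    (hmono : WeakQuasiStronglyMonotone F xs m 0) (hF : LipschitzWith L F)
    (hN : CenteredNoise P N κ) (hdens : PositiveDensityComponent P fun _ : ℕ => N) :
    ∃ θ : ℝ, 0 < θ ∧ ∃ π : ℝ → Measure (Eucl d), StationaryFamily P F N π xs θ κ ∧
      ∀ γ ∈ Ioo 0 θ, ∀ ν : Measure (Eucl d), IsProbabilityMeasure ν →
        Kernel.Invariant (sgdaKernel P F N γ) ν → ν = π γ := by
  have hsmall : ∀ᶠ γ : ℝ in 𝓝[>] 0, γ ≤ 1 ∧ γ * m ≤ 1 ∧ γ * L ^ 2 ≤ m := by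
    have hlim (a : ℝ) : Tendsto (fun γ : ℝ => γ * a) (𝓝[>] 0) (𝓝 0) :=
      tendsto_nhdsWithin_of_tendsto_nhds ((continuous_mul_const a).tendsto' 0 0 (zero_mul a))
    filter_upwards [(hlim 1).eventually_le_const one_pos, (hlim m).eventually_le_const one_pos,
      (hlim (L ^ 2)).eventually_le_const hm] with γ h1 h2 h3
    exact ⟨by simpa using h1, h2, h3⟩
  obtain ⟨θ, hθ, hstep⟩ := mem_nhdsGT_iff_exists_Ioo_subset.1 hsmall
  set c := (32 / m + 3) * κ ^ 4
  have hharris : ∀ γ ∈ Ioo 0 θ, ∃ R α, HarrisCondition (sgdaKernel P F N γ)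
      (fun x => ‖x - xs‖ ^ 4) (1 - γ * m / 2) (γ ^ 3 * c) R α := fun γ hγ =>
    exists_harrisCondition_sgdaKernel hxs hm hmono hF hN hdens hγ.1 (hstep hγ).1 (hstep hγ).2.1
      (hstep hγ).2.2
  choose! R α hH using hharris
  have := isMarkovKernel_sgdaKernel (P := P) hF.continuous.measurable hN.measurable
  choose! π hprob hinv using fun γ hγ => (hH γ hγ).exists_invariant
  have hmoment := fun γ hγ =>
    haveI := hprob γ hγ
    (hH γ hγ).integrable_and_integral_le_of_invariant (hinv γ hγ)
  refine ⟨θ, hθ, π, ⟨⟨hprob, fun γ hγ => (hmoment γ hγ).1, isBigO_principal.2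
    ⟨2 * c / m, fun γ hγ => ?_⟩⟩, hN, ⟨hF.continuous.stronglyMeasurable, ?_⟩, hinv⟩,
    fun γ hγ ν hν hνinv => ?_⟩
  · have hγ0 : 0 < γ := hγ.1
    rw [Real.norm_of_nonneg (integral_nonneg fun _ => by positivity),
      Real.norm_of_nonneg (sq_nonneg γ)]
    refine (hmoment γ hγ).2.trans_eq ?_
    field_simp
    ring
  · exact isBigO_top.2 ⟨L, fun x => by simpa [hxs] using hF.norm_sub_le x xs⟩
  · have := hprob γ hγ
    exact (hH γ hγ).eq_of_invariant hνinv (hinv γ hγ)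

set_option maxSynthPendingDepth 3 in
theorem StationaryFamily.exists_norm_integral_sub_sub_smul_le {π : ℝ → Measure (Eucl d)}
    (S : StationaryFamily P F N π xs θ κ) (hxs : F xs = 0) (hm : 0 < m)
    (hmono : WeakQuasiStronglyMonotone F xs m 0) (hF : SmoothOperator F L)
    (hcov : ContDiff ℝ 2 (covTensor P N))
    (hcov_bdd : ∀ i ∈ Finset.Icc 1 2, ∃ K : ℝ, ∀ x, ‖iteratedFDeriv ℝ i (covTensor P N) x‖ ≤ K) :
    ∃ (Δ : Eucl d) (K : ℝ), ∀ γ : ℝ, 0 < γ → γ < θ →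
      ‖∫ x, x ∂π γ - xs - γ • Δ‖ ≤ K * γ ^ 2 := by
  have hA : EulerContracting (fderiv ℝ F xs) :=
    eulerContracting_of_forall_inner_le hm (mul_norm_sq_le_inner_fderiv hxs
      (hF.contDiff.differentiable (by norm_num) xs) fun x => by simpa using hmono x)
  have hF1 := isBigO_sub_fderiv xs (hF.contDiff.of_le (by norm_num)) (hF.bounded 2 (by simp))
  have hF2 := isBigO_sub_fderiv_two xs (hF.contDiff.of_le (by norm_num)) (hF.bounded 3 (by simp))
  have hF3 := isBigO_sub_fderiv_three xs hF.contDiff (hF.bounded 4 (by simp))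
  have hc0 := isBigO_sub_taylor (n := 0) (hcov.of_le (by norm_num)) (hcov_bdd 1 (by simp)) xs
  have hc1 := isBigO_sub_fderiv xs hcov (hcov_bdd 2 (by simp))
  simp only [hxs, sub_zero] at hF1 hF2 hF3
  have hFc := hF.contDiff.continuous
  have hcc := hcov.continuous
  obtain ⟨Δ, hΔ⟩ := S.exists_integral_sub_sub_smul_isBigO_sq hA
    ⟨(by fun_prop : Continuous _).stronglyMeasurable, hF1⟩
    (Q := (2 : ℝ)⁻¹ • fderiv ℝ (fderiv ℝ F) xs)
    ⟨(by fun_prop : Continuous _).stronglyMeasurable, hF2⟩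
    (T := (6 : ℝ)⁻¹ • fderiv ℝ (fderiv ℝ (fderiv ℝ F)) xs)
    ⟨(by fun_prop : Continuous _).stronglyMeasurable, hF3⟩
    ⟨(by fun_prop : Continuous _).stronglyMeasurable, by simpa using hc0⟩
    ⟨(by fun_prop : Continuous _).stronglyMeasurable, hc1⟩
  obtain ⟨K, hK⟩ := isBigO_principal.1 hΔ
  refine ⟨Δ, K, fun γ h0 h => ?_⟩
  have := S.isProbabilityMeasure γ ⟨h0, h⟩
  have hcenter : ∫ x, (x - xs) ∂π γ = ∫ x, x ∂π γ - xs := by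
    rw [integral_sub (S.integrable_id ⟨h0, h⟩) (integrable_const xs), integral_const,
      probReal_univ, one_smul]
  rw [← hcenter]
  simpa using hK γ ⟨h0, h⟩

theorem norm_two_smul_sub_sub_le_of_forall_norm_sub_smul_le {E : Type*} [NormedAddCommGroup E]
    [NormedSpace ℝ E] {M : ℝ → E} {x Δ : E} {K : ℝ}
    (h : ∀ γ, 0 < γ → γ < θ → ‖M γ - x - γ • Δ‖ ≤ K * γ ^ 2) {γ : ℝ} (hγ : 0 < γ)
    (hγθ : 2 * γ < θ) : ‖(2 : ℝ) • M γ - M (2 * γ) - x‖ ≤ 6 * K * γ ^ 2 := calc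
  ‖(2 : ℝ) • M γ - M (2 * γ) - x‖
      = ‖(2 : ℝ) • (M γ - x - γ • Δ) - (M (2 * γ) - x - (2 * γ) • Δ)‖ := by congr 1; module
  _ ≤ 2 * ‖M γ - x - γ • Δ‖ + ‖M (2 * γ) - x - (2 * γ) • Δ‖ := by
    simpa [norm_smul] using norm_sub_le ((2 : ℝ) • (M γ - x - γ • Δ)) _
  _ ≤ 2 * (K * γ ^ 2) + K * (2 * γ) ^ 2 := by
    gcongr
    · exact h γ hγ (by linarith)
    · exact h (2 * γ) (by linarith) hγθ
  _ = 6 * K * γ ^ 2 := by ring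

theorem OracleNoise.centeredNoise (hU : OracleNoise P U σ) (hreg : RegularNoise P U κ G) :
    CenteredNoise P (U 0) κ where
  measurable := hU.measurable 0
  memLp_four x := by
    rw [← integrable_norm_rpow_iff (hU.memLp_two 0 x).aestronglyMeasurable (by norm_num)
      ENNReal.ofNat_ne_top]
    simpa using hreg.integrable_four 0 x
  integral_eq_zero x := by
    obtain ⟨ℱ, hℱ⟩ := hU.filtration
    rw [← integral_condExp (ℱ.le 0), integral_congr_ae (hℱ 0 x).2.1, integral_zero]
  fourth_moment x := (hreg.fourth_moment 0 x).le

theorem OracleNoise.sgdaKernel_eq (hU : OracleNoise P U σ) (hF : Measurable F) (γ : ℝ) (t : ℕ) :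
    sgdaKernel P F (U t) γ = sgdaKernel P F (U 0) γ := by
  ext x : 1
  rw [sgdaKernel_eq_map hF (hU.measurable t), sgdaKernel_eq_map hF (hU.measurable 0)]
  exact ((hU.identDistrib t).comp (u := fun f : Eucl d → Eucl d => x - γ • (F x + f x))
    (by fun_prop)).map_eq

theorem OracleNoise.sgdaStationary_iff (hU : OracleNoise P U σ) (hF : Measurable F) {γ : ℝ}
    {π : Measure (Eucl d)} :
    SGDAStationary P F U γ π ↔ SGDAStationary P F (fun _ => U 0) γ π := by
  constructor <;> rintro ⟨hprob, hinv⟩ <;> refine ⟨hprob, fun t => ?_⟩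
  · exact hinv 0
  · rw [hU.sgdaKernel_eq hF]
    exact hinv 0

theorem mainTheorem5_general (hxs : F xs = 0) (hm : 0 < m)
    (hmono : WeakQuasiStronglyMonotone F xs m 0) (hF : SmoothOperator F L)
    (hN : CenteredNoise P N κ) (hdens : PositiveDensityComponent P fun _ : ℕ => N)
    (hcov : ContDiff ℝ 2 (covTensor P N))
    (hcov_bdd : ∀ i ∈ Finset.Icc 1 2, ∃ K : ℝ, ∀ x, ‖iteratedFDeriv ℝ i (covTensor P N) x‖ ≤ K) :
    ∃ θ : ℝ, 0 < θ ∧ ∃ π : ℝ → Measure (Eucl d),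
      (∀ γ : ℝ, 0 < γ → γ < θ →
        SGDAStationary P F (fun _ => N) γ (π γ) ∧
        (∀ ν : Measure (Eucl d), SGDAStationary P F (fun _ => N) γ ν → ν = π γ) ∧
        Integrable (fun x => x) (π γ)) ∧
      (∃ (Δ : Eucl d) (K : ℝ), ∀ γ : ℝ, 0 < γ → γ < θ →
        ‖(∫ x, x ∂(π γ)) - xs - γ • Δ‖ ≤ K * γ ^ 2) ∧
      (∃ K : ℝ, ∀ γ : ℝ, 0 < γ → 2 * γ < θ →
        ‖(2 : ℝ) • (∫ x, x ∂(π γ)) - (∫ x, x ∂(π (2 * γ))) - xs‖ ≤ K * γ ^ 2) := by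
  obtain ⟨θ, hθ, π, S, huniq⟩ := exists_stationaryFamily hxs hm hmono hF.lipschitz hN hdens
  obtain ⟨Δ, K, hΔ⟩ := S.exists_norm_integral_sub_sub_smul_le hxs hm hmono hF hcov hcov_bdd
  refine ⟨θ, hθ, π, fun γ h0 h => ⟨⟨S.isProbabilityMeasure γ ⟨h0, h⟩,
    fun _ => S.invariant γ ⟨h0, h⟩⟩, fun ν hν => huniq γ ⟨h0, h⟩ ν hν.isProbabilityMeasure
      (hν.invariant 0), S.integrable_id ⟨h0, h⟩⟩, ⟨Δ, K, hΔ⟩, 6 * K, fun γ h0 h =>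
        norm_two_smul_sub_sub_le_of_forall_norm_sub_smul_le hΔ h0 h⟩

end Main

theorem mainTheorem5 {d : ℕ} {Ω : Type*} [MeasurableSpace Ω] (P : Measure Ω)
    [IsProbabilityMeasure P] (F : Eucl d → Eucl d) (U : ℕ → Eucl d → Ω → Eucl d)
    (xs : Eucl d) (m σ κ G : ℝ) (L : ℝ≥0)
    (hxs : F xs = 0) (hm : 0 < m) (hmono : WeakQuasiStronglyMonotone F xs m 0)
    (hF : SmoothOperator F L) (hσ : 0 < σ) (hU : OracleNoise P U σ)
    (hdens : PositiveDensityComponent P U) (hreg : RegularNoise P U κ G) :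
    ∃ θ : ℝ, 0 < θ ∧ ∃ π : ℝ → Measure (Eucl d),
      (∀ γ : ℝ, 0 < γ → γ < θ →
        SGDAStationary P F U γ (π γ) ∧
        (∀ ν : Measure (Eucl d), SGDAStationary P F U γ ν → ν = π γ) ∧
        Integrable (fun x => x) (π γ)) ∧
      (∃ (Δ : Eucl d) (K : ℝ), ∀ γ : ℝ, 0 < γ → γ < θ →
        ‖(∫ x, x ∂(π γ)) - xs - γ • Δ‖ ≤ K * γ ^ 2) ∧
      (∃ K : ℝ, ∀ γ : ℝ, 0 < γ → 2 * γ < θ →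
        ‖(2 : ℝ) • (∫ x, x ∂(π γ)) - (∫ x, x ∂(π (2 * γ))) - xs‖ ≤ K * γ ^ 2) := by
  have hFm := hF.lipschitz.continuous.measurable
  simp only [hU.sgdaStationary_iff hFm]
  exact mainTheorem5_general hxs hm hmono hF (hU.centeredNoise hreg) (hdens.const 0)
    ((hreg.cov_contDiff 0).of_le (by norm_num)) fun i hi =>
      ⟨G, fun x => (hreg.cov_bounded 0 i (Finset.Icc_subset_Icc_right (by norm_num) hi) x).le⟩
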